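/- Let $v\ge 1$ be an integer and let $K_v$ be the complete graph on $v$ vertices. For a graph $H$, an $H$-factor of $K_v$ is a set of subgraphs (blocks) of $K_v$, each isomorphic to $H$, such that every vertex of $K_v$ lies in exactly one of them. A $(K_2,K_{1,n})\text{-}\mathrm{URD}(v;1,s)$ is a set of subgraphs of $K_v$ such that every edge of $K_v$ lies in exactly one of them, partitioned into $1+s$ classes, of which one is a $K_2$-factor (a $1$-factor) and the other $s$ are $K_{1,n}$-factors ($n$-star factors). Let $n>1$ be an odd integer. Then a $(K_2,K_{1,n})\text{-}\mathrm{URD}(v;1,s)$ exists for some $s\ge 1$ if and only if $v\equiv 2(n+1)\pmod{n(n+1)}$. Moreover, whenever a $(K_2,K_{1,n})\text{-}\mathrm{URD}(v;1,s)$ with $s\ge 1$ exists, $s=\dfrac{(v-2)(n+1)}{2n}$. -/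

import Mathlib

namespace StarURD

/-- A set `D` of subgraphs (blocks) of `G` is a decomposition of `G` if every edge of `G` lies in
exactly one block of `D`. -/
def IsDecomposition {V : Type*} (G : SimpleGraph V) (D : Set G.Subgraph) : Prop :=
  ∀ e ∈ G.edgeSet, ∃! B : G.Subgraph, B ∈ D ∧ e ∈ B.edgeSet

/-- A set `F` of blocks is an `H`-factor of `G` (a resolution class of copies of `H`) if every
block is isomorphic to `H` and every vertex of `G` lies in exactly one block of `F`. -/
def IsFactor {V W : Type*} (G : SimpleGraph V) (H : SimpleGraph W) (F : Set G.Subgraph) : Prop :=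
  (∀ B ∈ F, Nonempty (B.coe ≃g H)) ∧ ∀ x : V, ∃! B : G.Subgraph, B ∈ F ∧ x ∈ B.verts

/-- An `(H₁, H₂)`-URD`(v; r, s)`: there is a decomposition of the complete graph `K_v` whose set
of blocks is partitioned into `r` classes that are `H₁`-factors and `s` classes that are
`H₂`-factors. -/
def ExistsURD {W₁ W₂ : Type*} (H₁ : SimpleGraph W₁) (H₂ : SimpleGraph W₂) (v r s : ℕ) : Prop :=
  ∃ (P : Fin r → Set (SimpleGraph.completeGraph (Fin v)).Subgraph)
    (Q : Fin s → Set (SimpleGraph.completeGraph (Fin v)).Subgraph),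
    IsDecomposition (SimpleGraph.completeGraph (Fin v)) ((⋃ i, P i) ∪ ⋃ j, Q j) ∧
    (∀ i i', i ≠ i' → Disjoint (P i) (P i')) ∧
    (∀ j j', j ≠ j' → Disjoint (Q j) (Q j')) ∧
    (∀ i j, Disjoint (P i) (Q j)) ∧
    (∀ i, IsFactor (SimpleGraph.completeGraph (Fin v)) H₁ (P i)) ∧
    (∀ j, IsFactor (SimpleGraph.completeGraph (Fin v)) H₂ (Q j))

/-- The complete graph `K_2`. -/
abbrev K₂ : SimpleGraph (Fin 2) := SimpleGraph.completeGraph (Fin 2)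

/-- The `n`-star `K_{1,n}`. -/
abbrev nStar (n : ℕ) : SimpleGraph (Fin 1 ⊕ Fin n) := completeBipartiteGraph (Fin 1) (Fin n)

end StarURD

/-!
Both directions rest on `n + 1` being coprime to `n`, and the existence on `n + 1` being even.

Necessity is a count (`ExistsURD.count`). A star factor has `v / (n + 1)` blocks with `n` edges each,
so counting the ordered pairs of vertices gives `v (n + 1) = 2 (n + 1) + 2 n s`. This is the formula
for `s`; as moreover `n + 1` divides `v`, it determines `v` modulo `n` and modulo `n + 1`.

For the existence write `v = m (n + 1)` with `m = 2 + j n`, and take as points `m` columns, indexed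
by `ℤ/m`, and `n + 1` rows. Everything is invariant under translation of the columns, so an edge
counts through its two rows and the difference of its columns. There are two kinds of star classes.
A class that consists of all stars with centre in row `p`, with one fixed difference to every other
row, is itself invariant, and it may use *any* differences between rows. One further class `F`,
together with its `m` translates, has to take all differences inside the rows, except the one used
by the matching. Hence only numbers matter for the differences between rows: `F` and the matching
have to leave over `A p + A q` differences between the rows `p` and `q`, for some numbers `A p` of
invariant classes centred on row `p` (`existsURD_of_differences`).

The class `F` comes from a packing of stars into one row (`IsPacking`, `packingClass`). Stars that
stay in their row take the differences `1, …, B`, once in each row. If `m` is odd, then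
`m = 2 (t n + h) + 1` with `h = (n + 1) / 2`; a last star with only `h` leaves in its row `p` sends
its other `h - 1` leaves to the rows `p + 1, …, p + h - 1`, so that between two rows exactly one
difference is taken, if the matching pairs the rows `p` and `p + h`. If `m` is even, then
`m = 2 t n + 2`, and the matching takes the involution of `ℤ/m` in each row. The remaining points
`y` are covered by stars centred on row `0` with a leaf in every other row. Reflecting row `0` makes
their differences `2 y`; these have to be distinct, and different from those of the last stars.

The packing (`centre`) places the `t` stars alternately in two intervals of length about `t n`, in
the manner of graceful labellings. It fits exactly. For odd `m` it leaves room for the last star in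
the positions required; for even `m` the gaps of each interval are opposite to the leaves in the
other one (`exists_usedInt_eq`), so no two remaining points are opposite and the `2 y` are distinct.
-/

namespace StarURD

/-! ### From star classes to a resolvable decomposition -/

/-- The star with centre `a none` and leaves `a (some i)`, as a block of the complete graph. -/
def starBlock {v k : ℕ} (a : Option (Fin k) → Fin v) :
    (SimpleGraph.completeGraph (Fin v)).Subgraph where
  verts := Set.range a
  Adj x y := x ≠ y ∧
    ((x = a none ∧ ∃ i, y = a (some i)) ∨ (y = a none ∧ ∃ i, x = a (some i)))
  adj_sub h := h.1
  edge_vert h := by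
    rcases h.2 with ⟨h, -⟩ | ⟨-, i, h⟩
    · exact ⟨none, h.symm⟩
    · exact ⟨some i, h.symm⟩
  symm := ⟨fun x y h => ⟨h.1.symm, h.2.symm⟩⟩

theorem nonempty_starBlock_iso {v k : ℕ} {a : Option (Fin k) → Fin v}
    (ha : Function.Injective a) : Nonempty ((starBlock a).coe ≃g nStar k) := by
  let o : Fin 1 ⊕ Fin k ≃ Option (Fin k) :=
    { toFun := Sum.elim (fun _ => none) some
      invFun := fun x => x.elim (Sum.inl 0) Sum.inr
      left_inv := by
        rintro (x | x)
        · simp [Subsingleton.elim x 0]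
        · simp
      right_inv := by rintro (_ | x) <;> simp }
  refine ⟨SimpleGraph.Iso.symm ⟨o.trans (Equiv.ofInjective a ha), ?_⟩⟩
  intro x y
  change (starBlock a).Adj (a (o x)) (a (o y)) ↔ _
  have hl z : o (Sum.inl z) = none := rfl
  have hr z : o (Sum.inr z) = some z := rfl
  rcases x with x | x <;> rcases y with y | y <;>
    simp [starBlock, hl, hr, ha.eq_iff]

/-- The complete graph `K₂` is the star with one leaf. -/
theorem nonempty_nStar_one_iso : Nonempty (nStar 1 ≃g K₂) := by
  refine ⟨⟨finSumFinEquiv, ?_⟩⟩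
  intro x y
  rcases x with x | x <;> rcases y with y | y <;> fin_cases x <;> fin_cases y <;> simp

/-- The two vertices `x` and `y` are joined by a star of the class `φ`, which consists of the stars
with centre `φ (c, none)` and leaves `φ (c, some i)`. -/
def Joined {V C : Type*} {k : ℕ} (φ : C × Option (Fin k) → V) (x y : V) : Prop :=
  ∃ c i, (φ (c, none) = x ∧ φ (c, some i) = y) ∨ (φ (c, none) = y ∧ φ (c, some i) = x)

theorem Joined.symm {V C : Type*} {k : ℕ} {φ : C × Option (Fin k) → V} {x y : V}
    (h : Joined φ x y) : Joined φ y x := by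
  obtain ⟨c, i, h⟩ := h
  exact ⟨c, i, h.symm⟩

/-- The blocks of the class `φ`. -/
def classBlocks {C : Type*} {k v : ℕ} (φ : C × Option (Fin k) → Fin v) :
    Set (SimpleGraph.completeGraph (Fin v)).Subgraph :=
  Set.range fun c => starBlock fun o => φ (c, o)

theorem isFactor_classBlocks {C : Type*} {k v : ℕ} {φ : C × Option (Fin k) → Fin v}
    (hφ : Function.Bijective φ) :
    IsFactor (SimpleGraph.completeGraph (Fin v)) (nStar k) (classBlocks φ) := by
  refine ⟨?_, fun x => ?_⟩
  · rintro _ ⟨c, rfl⟩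
    exact nonempty_starBlock_iso fun o o' h => (Prod.ext_iff.1 (hφ.1 h)).2
  · obtain ⟨⟨c, o⟩, rfl⟩ := hφ.2 x
    refine ⟨_, ⟨⟨c, rfl⟩, ⟨o, rfl⟩⟩, ?_⟩
    rintro _ ⟨⟨c', rfl⟩, ⟨o', h⟩⟩
    have hc : c' = c := (Prod.ext_iff.1 (hφ.1 h)).1
    rw [hc]

/-- An edge lies in a block of a class exactly if the class joins its ends, and this block is
then unique. -/
theorem adj_classBlocks {C : Type*} {k v : ℕ} {φ : C × Option (Fin k) → Fin v}
    {x y : Fin v} (hxy : x ≠ y) :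
    (∃ B ∈ classBlocks φ, B.Adj x y) ↔ Joined φ x y := by
  constructor
  · rintro ⟨_, ⟨c, rfl⟩, -, ⟨rfl, i, rfl⟩ | ⟨rfl, i, rfl⟩⟩
    · exact ⟨c, i, Or.inl ⟨rfl, rfl⟩⟩
    · exact ⟨c, i, Or.inr ⟨rfl, rfl⟩⟩
  · rintro ⟨c, i, ⟨rfl, rfl⟩ | ⟨rfl, rfl⟩⟩
    · exact ⟨_, ⟨c, rfl⟩, hxy, Or.inl ⟨rfl, i, rfl⟩⟩
    · exact ⟨_, ⟨c, rfl⟩, hxy, Or.inr ⟨rfl, i, rfl⟩⟩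

theorem isFactor_adj_unique {W : Type*} {v : ℕ} {H : SimpleGraph W}
    {F : Set (SimpleGraph.completeGraph (Fin v)).Subgraph}
    (hF : IsFactor (SimpleGraph.completeGraph (Fin v)) H F) {x y : Fin v}
    {B B' : (SimpleGraph.completeGraph (Fin v)).Subgraph} (hB : B ∈ F) (hB' : B' ∈ F)
    (h : B.Adj x y) (h' : B'.Adj x y) : B = B' :=
  (hF.2 x).unique ⟨hB, B.edge_vert h⟩ ⟨hB', B'.edge_vert h'⟩

/-- The blocks `{x, μ x}` of a perfect matching `μ`. -/
def matchingBlocks {v : ℕ} (μ : Fin v → Fin v) :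
    Set (SimpleGraph.completeGraph (Fin v)).Subgraph :=
  Set.range fun x => starBlock fun o : Option (Fin 1) => o.elim x fun _ => μ x

theorem adj_matchingBlocks {v : ℕ} {μ : Fin v → Fin v} (hμ : Function.Involutive μ)
    {x y : Fin v} (hxy : x ≠ y) : (∃ B ∈ matchingBlocks μ, B.Adj x y) ↔ μ x = y := by
  constructor
  · rintro ⟨_, ⟨c, rfl⟩, -, ⟨rfl, i, rfl⟩ | ⟨rfl, i, rfl⟩⟩
    · rfl
    · exact hμ _
  · rintro rfl
    exact ⟨_, ⟨x, rfl⟩, hxy, Or.inl ⟨rfl, 0, rfl⟩⟩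

theorem isFactor_matchingBlocks {v : ℕ} {μ : Fin v → Fin v} (hμ : Function.Involutive μ)
    (hμ' : ∀ x, μ x ≠ x) :
    IsFactor (SimpleGraph.completeGraph (Fin v)) K₂ (matchingBlocks μ) := by
  refine ⟨?_, fun x => ⟨_, ⟨⟨x, rfl⟩, ⟨none, rfl⟩⟩, ?_⟩⟩
  · rintro _ ⟨x, rfl⟩
    obtain ⟨f⟩ := nonempty_starBlock_iso (a := fun o : Option (Fin 1) => o.elim x fun _ => μ x) (by
      rintro (_ | i) (_ | j) h
      · rfl
      · exact absurd h.symm (hμ' x)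
      · exact absurd h (hμ' x)
      · rw [Subsingleton.elim i j])
    obtain ⟨g⟩ := nonempty_nStar_one_iso
    exact ⟨f.trans g⟩
  · rintro _ ⟨⟨y, rfl⟩, ⟨o, h⟩⟩
    rcases o with _ | i
    · have : y = x := h
      rw [this]
    · have : μ y = x := h
      subst this
      ext a b
      · simp only [starBlock, Set.mem_range, Option.exists, Option.elim, hμ y, exists_const]
        exact or_comm
      · simp only [starBlock, Option.elim, hμ y, exists_const]
        tauto

/-- Star classes and a perfect matching `μ` on a set of `v` points form a resolvable decomposition
as soon as any two points are joined exactly once. -/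
theorem existsURD_of_joined {V S : Type*} [Fintype S] {C : S → Type*} {n v : ℕ} (hn : 0 < n)
    (e : V ≃ Fin v) (φ : ∀ σ, C σ × Option (Fin n) → V) (hφ : ∀ σ, Function.Bijective (φ σ))
    (μ : V → V) (hμ : Function.Involutive μ) (hμ' : ∀ x, μ x ≠ x)
    (h₁ : ∀ x σ, ¬ Joined (φ σ) x (μ x))
    (h₂ : ∀ x y, x ≠ y → μ x ≠ y → ∃! σ, Joined (φ σ) x y) :
    ExistsURD K₂ (nStar n) v 1 (Fintype.card S) := by
  set ψ : ∀ σ, C σ × Option (Fin n) → Fin v := fun σ => e ∘ φ σ with hψ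
  have hψb σ : Function.Bijective (ψ σ) := e.bijective.comp (hφ σ)
  set ν : Fin v → Fin v := fun x => e (μ (e.symm x)) with hν
  have hνi : Function.Involutive ν := fun x => by simp [hν, hμ (e.symm x)]
  have hν' x : ν x ≠ x := fun h => hμ' (e.symm x) (by
    rw [← e.symm_apply_apply (μ _)]
    exact congrArg e.symm h)
  have hJ σ (x y : Fin v) : Joined (ψ σ) x y ↔ Joined (φ σ) (e.symm x) (e.symm y) := by
    simp only [Joined, hψ, Function.comp, Equiv.eq_symm_apply]
  let E : Fin (Fintype.card S) ≃ S := (Fintype.equivFin S).symm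
  have hQ σ := isFactor_classBlocks (hψb σ)
  have hP := isFactor_matchingBlocks hνi hν'
  -- a block of a class has an edge, and the class is determined by this edge
  have hedge σ B (hB : B ∈ classBlocks (ψ σ)) : ∃ x y, x ≠ y ∧ B.Adj x y := by
    obtain ⟨c, rfl⟩ := hB
    have : ψ σ (c, none) ≠ ψ σ (c, some ⟨0, hn⟩) := fun h => by
      simpa using (hψb σ).1 h
    exact ⟨_, _, this, this, Or.inl ⟨rfl, _, rfl⟩⟩
  have hPQ σ (x y : Fin v) (hxy : x ≠ y) (hj : Joined (ψ σ) x y) : ν x ≠ y := by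
    rintro rfl
    exact h₁ _ σ (by simpa [hν] using (hJ _ _ _).1 hj)
  have hQQ σ τ (x y : Fin v) (hxy : x ≠ y) (hj : Joined (ψ σ) x y) (hj' : Joined (ψ τ) x y) :
      σ = τ := by
    refine (h₂ (e.symm x) (e.symm y) (by simpa using hxy) ?_).unique
      ((hJ _ _ _).1 hj) ((hJ _ _ _).1 hj')
    intro h
    exact hPQ σ x y hxy hj (by simp [hν, h])
  refine ⟨fun _ => matchingBlocks ν, fun j => classBlocks (ψ (E j)), ?_, ?_, ?_, ?_, fun _ => hP,
    fun j => hQ _⟩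
  · intro s
    induction s using Sym2.ind with
    | _ x y =>
    intro hs
    have hxy : x ≠ y := by simpa using hs
    simp only [SimpleGraph.Subgraph.mem_edgeSet, Set.mem_union, Set.mem_iUnion]
    by_cases hxy' : ν x = y
    · obtain ⟨B, hB, hB'⟩ := (adj_matchingBlocks hνi hxy).2 hxy'
      refine ⟨B, ⟨Or.inl ⟨0, hB⟩, hB'⟩, ?_⟩
      rintro B₁ ⟨⟨_, h⟩ | ⟨j, h⟩, h'⟩
      · exact isFactor_adj_unique hP h hB h' hB'
      · exact absurd hxy' (hPQ _ x y hxy ((adj_classBlocks hxy).1 ⟨_, h, h'⟩))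
    · obtain ⟨σ, hσ, -⟩ := h₂ (e.symm x) (e.symm y) (by simpa using hxy)
        (fun h => hxy' (by simp [hν, h]))
      obtain ⟨j₀, rfl⟩ := E.surjective σ
      have hσ' := (hJ _ x y).2 hσ
      obtain ⟨B, hB, hB'⟩ := (adj_classBlocks hxy).2 hσ'
      refine ⟨B, ⟨Or.inr ⟨j₀, hB⟩, hB'⟩, ?_⟩
      rintro B₁ ⟨⟨_, h⟩ | ⟨j, h⟩, h'⟩
      · exact absurd ((adj_matchingBlocks hνi hxy).1 ⟨_, h, h'⟩) hxy'
      · have := hQQ _ _ x y hxy ((adj_classBlocks hxy).1 ⟨_, h, h'⟩) hσ'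
        rw [this] at h
        exact isFactor_adj_unique (hQ _) h hB h' hB'
  · exact fun i i' h => absurd (Subsingleton.elim i i') h
  · intro j j' hjj
    rw [Set.disjoint_left]
    intro B hB hB'
    obtain ⟨x, y, hxy, hadj⟩ := hedge _ B hB
    exact hjj (E.injective (hQQ _ _ x y hxy ((adj_classBlocks hxy).1 ⟨_, hB, hadj⟩)
      ((adj_classBlocks hxy).1 ⟨_, hB', hadj⟩)))
  · intro i j
    rw [Set.disjoint_left]
    intro B hB hB'
    obtain ⟨x, y, hxy, hadj⟩ := hedge _ B hB'
    exact hPQ _ x y hxy ((adj_classBlocks hxy).1 ⟨_, hB', hadj⟩)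
      ((adj_matchingBlocks hνi hxy).1 ⟨_, hB, hadj⟩)

/-! ### Translation by a cyclic group -/

/-- The vertices: the column is taken from `ℤ/m` and acts by translation, the row from
`Fin (n + 1)`. -/
abbrev Point (m n : ℕ) : Type := ZMod m × Fin (n + 1)

/-- Among the stars with centre `φ ι (c, none)` and leaves `φ ι (c, some i)` there is an arc, from
centre to leaf, that leads from row `p` to row `q` with difference `δ`. -/
def IsArc {m n : ℕ} {I C : Type} (φ : I → C × Option (Fin n) → Point m n)
    (p q : Fin (n + 1)) (δ : ZMod m) : Prop :=
  ∃ ι c i, (φ ι (c, none)).2 = p ∧ (φ ι (c, some i)).2 = q ∧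
    (φ ι (c, some i)).1 - (φ ι (c, none)).1 = δ

/-- The class of stars with centres `(x, p)`, for `x` in `ℤ/m`, and leaves `(x + E q, q)`, for
`q ≠ p`. -/
def rowClass {m n : ℕ} (p : Fin (n + 1)) (E : Fin (n + 1) → ZMod m) :
    ZMod m × Option (Fin n) → Point m n := fun a =>
  (a.1 + E (p + (finSuccEquiv n).symm a.2), p + (finSuccEquiv n).symm a.2)

theorem rowClass_bijective {m n : ℕ} (p : Fin (n + 1)) (E : Fin (n + 1) → ZMod m) :
    Function.Bijective (rowClass p E) := by
  constructor
  · rintro ⟨x, o⟩ ⟨y, o'⟩ h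
    simp only [rowClass, Prod.mk.injEq] at h
    obtain ⟨h1, h2⟩ := h
    have : o = o' := by simpa using h2
    subst this
    simpa using h1
  · rintro ⟨x, q⟩
    refine ⟨(x - E q, finSuccEquiv n (q - p)), ?_⟩
    simp [rowClass]

theorem joined_rowClass {m n : ℕ} {r : Fin (n + 1)} {E : Fin (n + 1) → ZMod m} (hE : E r = 0)
    {p q : Fin (n + 1)} (hpq : p ≠ q) (a b : ZMod m) :
    Joined (rowClass r E) (a, p) (b, q) ↔ (r = p ∧ E q = b - a) ∨ (r = q ∧ E p = a - b) := by
  have hs (s : Fin (n + 1)) (hs : s ≠ r) : ∃ i : Fin n, r + (finSuccEquiv n).symm (some i) = s := by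
    rcases h : finSuccEquiv n (s - r) with _ | i
    · rw [← Equiv.eq_symm_apply] at h
      exact absurd (sub_eq_zero.1 (by simpa using h)) hs
    · refine ⟨i, ?_⟩
      rw [← h]
      simp
  constructor
  · rintro ⟨c, i, h | h⟩ <;>
      simp only [rowClass, finSuccEquiv_symm_none, add_zero, hE, Prod.mk.injEq] at h <;>
      obtain ⟨⟨rfl, rfl⟩, rfl, rfl⟩ := h
    · exact Or.inl ⟨rfl, by ring⟩
    · exact Or.inr ⟨rfl, by ring⟩
  · rintro (⟨rfl, h⟩ | ⟨rfl, h⟩)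
    · obtain ⟨i, hi⟩ := hs q hpq.symm
      exact ⟨a, i, Or.inl ⟨by simp [rowClass, hE], by simp only [rowClass, hi, h]; simp⟩⟩
    · obtain ⟨i, hi⟩ := hs p hpq
      exact ⟨b, i, Or.inr ⟨by simp [rowClass, hE], by simp only [rowClass, hi, h]; simp⟩⟩

theorem not_joined_rowClass {m n : ℕ} (r : Fin (n + 1)) (E : Fin (n + 1) → ZMod m)
    (p : Fin (n + 1)) (a b : ZMod m) : ¬ Joined (rowClass r E) (a, p) (b, p) := by
  rintro ⟨c, i, h | h⟩ <;>
    simp only [rowClass, finSuccEquiv_symm_none, add_zero, Prod.mk.injEq] at h <;>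
    obtain ⟨⟨-, rfl⟩, -, h⟩ := h <;>
    simp at h

/-- If as many differences `δ` from row `p` to row `q` are left over as the classes centred on
these two rows need, the differences can be dealt out to these classes. The choice `E p α q` is the
difference from row `p` to row `q` in the class number `α` centred on row `p`. -/
theorem exists_row_differences {m n : ℕ} [NeZero m] (A : Fin (n + 1) → ℕ)
    (R : Fin (n + 1) → Fin (n + 1) → ZMod m → Prop)
    (hR : ∀ p q, p < q → Nat.card {δ // R p q δ} = A p + A q) :
    ∃ E : ∀ p : Fin (n + 1), Fin (A p) → Fin (n + 1) → ZMod m,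
      (∀ p α, E p α p = 0) ∧ ∀ p q, p < q →
        (∀ α, R p q (E p α q)) ∧ (∀ α, R p q (-E q α p)) ∧
        ∀ δ, R p q δ → ∃! s : Fin (A p) ⊕ Fin (A q),
          Sum.elim (fun α => E p α q) (fun α => -E q α p) s = δ := by
  have hψ p q (h : p < q) : Nonempty (Fin (A p) ⊕ Fin (A q) ≃ {δ // R p q δ}) := by
    refine ⟨finSumFinEquiv.trans (Finite.equivFinOfCardEq (hR p q h)).symm⟩
  let ψ p q h := (hψ p q h).some
  refine ⟨fun p α q => if h : p < q then ψ p q h (Sum.inl α) else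
    if h : q < p then -(ψ q p h (Sum.inr α)).1 else 0, by simp, fun p q h => ?_⟩
  have h' : ¬ q < p := h.asymm
  refine ⟨fun α => ?_, fun α => ?_, fun δ hδ => ?_⟩
  · simp only [h, dite_true]
    exact (ψ p q h _).2
  · simp only [h, h', dite_true, dite_false, neg_neg]
    exact (ψ p q h _).2
  · simp only [h, h', dite_true, dite_false, neg_neg]
    have he s : Sum.elim (fun α => (ψ p q h (Sum.inl α)).1) (fun α => (ψ p q h (Sum.inr α)).1) s
        = (ψ p q h s).1 := by
      rcases s with s | s <;> rfl
    refine ⟨(ψ p q h).symm ⟨δ, hδ⟩, by simp only [he]; simp, fun s hs => ?_⟩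
    rw [Equiv.eq_symm_apply]
    exact Subtype.ext ((he s).symm.trans hs)

theorem joined_translate {m n : ℕ} {C : Type} (φ : C × Option (Fin n) → Point m n)
    (τ a b : ZMod m) (p q : Fin (n + 1)) :
    Joined (fun u => ((φ u).1 + τ, (φ u).2)) (a, p) (b, q) ↔
      Joined φ (a - τ, p) (b - τ, q) := by
  simp only [Joined, Prod.ext_iff, eq_sub_iff_add_eq]

/-- The construction. A matching and finitely many star classes `φ ι` are given such that the arcs
of these classes have pairwise different differences, also up to reversal, avoid the difference of
the matching, and exhaust with it the differences inside each row. The translates of the classes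
`φ ι`, together with `A p` translation invariant classes centred on each row `p`, form a resolvable
decomposition if the numbers of remaining differences between the rows are right. -/
theorem existsURD_of_differences {m n : ℕ} [NeZero m] (hn : 0 < n) {I C : Type} [Fintype I]
    (φ : I → C × Option (Fin n) → Point m n) (hφ : ∀ ι, Function.Bijective (φ ι))
    (θ : Fin (n + 1) → Fin (n + 1)) (ε : Fin (n + 1) → ZMod m) (A : Fin (n + 1) → ℕ)
    (hθ : ∀ p, θ (θ p) = p) (hε : ∀ p, ε (θ p) = -ε p) (hθε : ∀ p, θ p = p → ε p ≠ 0)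
    (hinj : ∀ ι c i ι' c' i', (φ ι (c, none)).2 = (φ ι' (c', none)).2 →
      (φ ι (c, some i)).2 = (φ ι' (c', some i')).2 →
      (φ ι (c, some i)).1 - (φ ι (c, none)).1 = (φ ι' (c', some i')).1 - (φ ι' (c', none)).1 →
      (ι, c, i) = (ι', c', i'))
    (hopp : ∀ p q δ, IsArc φ p q δ → ¬ IsArc φ q p (-δ))
    (hM : ∀ p, ¬ IsArc φ p (θ p) (ε p))
    (hpure : ∀ p δ, δ ≠ 0 → (θ p = p ∧ ε p = δ) ∨ IsArc φ p p δ ∨ IsArc φ p p (-δ))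
    (hA : ∀ p q, p < q → Nat.card {δ // ¬(θ p = q ∧ ε p = δ) ∧ ¬ IsArc φ p q δ ∧
      ¬ IsArc φ q p (-δ)} = A p + A q) :
    ExistsURD K₂ (nStar n) (m * (n + 1)) 1 (Fintype.card ((I × ZMod m) ⊕ Σ p, Fin (A p))) := by
  obtain ⟨E, hE0, hE⟩ := exists_row_differences A _ hA
  let C' : (I × ZMod m) ⊕ (Σ p, Fin (A p)) → Type := Sum.elim (fun _ => C) (fun _ => ZMod m)
  let Φ : ∀ σ, C' σ × Option (Fin n) → Point m n := fun σ =>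
    match σ with
    | Sum.inl (ι, τ) => fun u => ((φ ι u).1 + τ, (φ ι u).2)
    | Sum.inr ⟨p, α⟩ => rowClass p (E p α)
  have hΦl ι τ a b p q : Joined (Φ (Sum.inl (ι, τ))) (a, p) (b, q) ↔
      Joined (φ ι) (a - τ, p) (b - τ, q) := joined_translate _ _ _ _ _ _
  have hΦr r α a b p q (hpq : p ≠ q) : Joined (Φ (Sum.inr ⟨r, α⟩)) (a, p) (b, q) ↔
      (r = p ∧ E r α q = b - a) ∨ (r = q ∧ E r α p = a - b) :=
    joined_rowClass (hE0 r α) hpq a b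
  have hΦp r α a b p : ¬ Joined (Φ (Sum.inr ⟨r, α⟩)) (a, p) (b, p) := not_joined_rowClass _ _ _ _ _
  have harc ι a b p q (h : Joined (φ ι) (a, p) (b, q)) :
      IsArc φ p q (b - a) ∨ IsArc φ q p (-(b - a)) := by
    obtain ⟨c, i, ⟨h1, h2⟩ | ⟨h1, h2⟩⟩ := h
    · exact Or.inl ⟨ι, c, i, by rw [h1], by rw [h2], by rw [h1, h2]⟩
    · exact Or.inr ⟨ι, c, i, by rw [h1], by rw [h2], by rw [h1, h2, neg_sub]⟩
  have hM' p : ¬ IsArc φ (θ p) p (-ε p) := by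
    have := hM (θ p)
    rwa [hθ, hε] at this
  -- the class of an arc and its translate are determined by the pair of points
  have hex p q (a b : ZMod m) (h : IsArc φ p q (b - a)) :
      ∃! στ : I × ZMod m, Joined (Φ (Sum.inl στ)) (a, p) (b, q) := by
    obtain ⟨ι, c, i, h1, h2, h3⟩ := id h
    refine ⟨(ι, a - (φ ι (c, none)).1), (hΦl _ _ _ _ _ _).2 ⟨c, i, Or.inl ⟨?_, ?_⟩⟩, ?_⟩
    · ext1
      · simp
      · exact h1
    · ext1
      · simp only
        linear_combination h3
      · exact h2
    · rintro ⟨ι', τ⟩ h'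
      obtain ⟨c', i', ⟨h1', h2'⟩ | ⟨h1', h2'⟩⟩ := (hΦl _ _ _ _ _ _).1 h'
      · have := hinj ι c i ι' c' i' (by rw [h1, h1']) (by rw [h2, h2'])
          (by rw [h3, h1', h2']; ring)
        simp only [Prod.mk.injEq] at this
        obtain ⟨rfl, rfl, rfl⟩ := this
        rw [h1']
        simp
      · exact absurd ⟨ι', c', i', by rw [h1'], by rw [h2'], by rw [h1', h2']; ring⟩
          (hopp _ _ _ h)
  have hswap p q (a b : ZMod m) (h : IsArc φ p q (b - a) ∨ IsArc φ q p (-(b - a))) :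
      ∃! στ : I × ZMod m, Joined (Φ (Sum.inl στ)) (a, p) (b, q) := by
    rcases h with h | h
    · exact hex p q a b h
    · rw [neg_sub] at h
      obtain ⟨στ, h1, h2⟩ := hex q p b a h
      exact ⟨στ, h1.symm, fun στ' h' => h2 _ h'.symm⟩
  have hlt p q a b (hpq : p < q) (hμ : ¬ (θ p = q ∧ ε p = b - a)) :
      ∃! σ, Joined (Φ σ) (a, p) (b, q) := by
    by_cases h : IsArc φ p q (b - a) ∨ IsArc φ q p (-(b - a))
    · obtain ⟨στ, h1, h2⟩ := hswap p q a b h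
      refine ⟨Sum.inl στ, h1, ?_⟩
      rintro (στ' | ⟨r, α⟩) h'
      · rw [h2 _ h']
      · rw [hΦr _ _ _ _ _ _ hpq.ne] at h'
        rcases h' with ⟨rfl, h'⟩ | ⟨rfl, h'⟩
        · have := (hE _ _ hpq).1 α
          rw [h'] at this
          tauto
        · have := (hE _ _ hpq).2.1 α
          rw [h', neg_sub] at this
          tauto
    · rw [not_or] at h
      obtain ⟨s, h1, h2⟩ := (hE p q hpq).2.2 (b - a) ⟨hμ, h⟩
      have key r (α : Fin (A r)) : Joined (Φ (Sum.inr ⟨r, α⟩)) (a, p) (b, q) ↔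
          (r = p ∧ E r α q = b - a) ∨ (r = q ∧ -E r α p = b - a) := by
        rw [hΦr _ _ _ _ _ _ hpq.ne, neg_eq_iff_eq_neg, neg_sub]
      refine ⟨Sum.inr (s.elim (fun α => ⟨p, α⟩) fun α => ⟨q, α⟩), ?_, ?_⟩
      · rcases s with s | s
        · exact (key _ _).2 (Or.inl ⟨rfl, h1⟩)
        · exact (key _ _).2 (Or.inr ⟨rfl, h1⟩)
      · rintro (⟨ι, τ⟩ | ⟨r, α⟩) h'
        · have := harc _ _ _ _ _ ((hΦl _ _ _ _ _ _).1 h')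
          rw [sub_sub_sub_cancel_right] at this
          tauto
        · rcases (key _ _).1 h' with ⟨rfl, hs⟩ | ⟨rfl, hs⟩
          · rw [← h2 (Sum.inl α) hs]
            rfl
          · rw [← h2 (Sum.inr α) hs]
            rfl
  have hcard : Fintype.card (Point m n) = m * (n + 1) := by simp [ZMod.card]
  refine existsURD_of_joined hn (Fintype.equivFinOfCardEq hcard) Φ ?_
    (fun u => (u.1 + ε u.2, θ u.2)) ?_ ?_ ?_ ?_
  · rintro (⟨ι, τ⟩ | ⟨p, α⟩)
    · exact ((Equiv.addRight τ).prodCongr (Equiv.refl (Fin (n + 1)))).bijective.comp (hφ ι)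
    · exact rowClass_bijective _ _
  · rintro ⟨x, p⟩
    simp [hθ, hε]
  · rintro ⟨x, p⟩ h
    simp only [Prod.mk.injEq, add_eq_left] at h
    exact hθε p h.2 h.1
  · rintro ⟨x, p⟩ (⟨ι, τ⟩ | ⟨r, α⟩) h
    · have := harc _ _ _ _ _ ((hΦl _ _ _ _ _ _).1 h)
      have he : x + ε p - τ - (x - τ) = ε p := by ring
      rw [he] at this
      exact this.elim (hM p) (hM' p)
    · simp only at h
      rcases lt_trichotomy p (θ p) with hp | hp | hp
      · rcases (hΦr _ _ _ _ _ _ hp.ne).1 h with ⟨rfl, h'⟩ | ⟨rfl, h'⟩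
        · exact ((hE _ _ hp).1 α).1 ⟨rfl, by rw [h']; ring⟩
        · exact ((hE _ _ hp).2.1 α).1 ⟨rfl, by rw [h']; ring⟩
      · rw [← hp] at h
        exact hΦp _ _ _ _ _ h
      · rcases (hΦr _ _ _ _ _ _ hp.ne').1 h with ⟨rfl, h'⟩ | ⟨rfl, h'⟩
        · exact ((hE _ _ hp).2.1 α).1 ⟨hθ _, by rw [h', hε]; ring⟩
        · exact ((hE _ _ hp).1 α).1 ⟨hθ _, by rw [h', hε]; ring⟩
  · rintro ⟨a, p⟩ ⟨b, q⟩ hne hμ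
    have hμ1 : ¬ (θ p = q ∧ ε p = b - a) := by
      rintro ⟨rfl, h⟩
      exact hμ (by simp [h])
    rcases lt_trichotomy p q with hpq | rfl | hpq
    · exact hlt p q a b hpq hμ1
    · have hδ : b - a ≠ 0 := fun h => hne (by rw [sub_eq_zero.1 h])
      have := (hpure p _ hδ).resolve_left hμ1
      obtain ⟨στ, h1, h2⟩ := hswap p p a b this
      refine ⟨Sum.inl στ, h1, ?_⟩
      rintro (στ' | ⟨r, α⟩) h'
      · rw [h2 _ h']
      · exact absurd h' (hΦp _ _ _ _ _)
    · obtain ⟨σ, h1, h2⟩ := hlt q p b a hpq (by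
        rintro ⟨rfl, h⟩
        exact hμ1 ⟨hθ q, by rw [hε, h]; ring⟩)
      exact ⟨σ, h1.symm, fun σ' h' => h2 _ h'.symm⟩

/-! ### The star class of a packing -/

/-- The reflection of row `0`: columns of row `p` are multiplied by `rowSign p`. -/
def rowSign {m n : ℕ} (p : Fin (n + 1)) : ZMod m := if p = 0 then -1 else 1

theorem rowSign_mul_self {m n : ℕ} (p : Fin (n + 1)) :
    (rowSign p : ZMod m) * rowSign p = 1 := by
  unfold rowSign
  split_ifs <;> simp

theorem rowSign_zero {m n : ℕ} : (rowSign (0 : Fin (n + 1)) : ZMod m) = -1 := by simp [rowSign]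

theorem rowSign_of_ne {m n : ℕ} {p : Fin (n + 1)} (hp : p ≠ 0) : (rowSign p : ZMod m) = 1 := by
  simp [rowSign, hp]

theorem rowSign_mul_cancel {m n : ℕ} {p : Fin (n + 1)} {a b : ZMod m}
    (h : rowSign p * a = rowSign p * b) : a = b := by
  have := congrArg (rowSign p * ·) h
  simpa [← mul_assoc, rowSign_mul_self] using this

/-- The points of a row, up to reflection, that are taken by the centres `c e`, for `e < E`, the
leaves `c (N / n) + (N + 1)`, for `N < B`, and the leaves `-(d + 1)`, for `d < s`, that come from
other rows. -/
def usedPoint {m : ℕ} (n E B s : ℕ) (c : ℕ → ZMod m) : Fin E ⊕ Fin B ⊕ Fin s → ZMod m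
  | Sum.inl e => c e
  | Sum.inr (Sum.inl N) => c (N / n) + ((N + 1 : ℕ) : ZMod m)
  | Sum.inr (Sum.inr d) => -((d + 1 : ℕ) : ZMod m)

/-- The points of a row, up to reflection, that are left over. -/
def freePoints {m : ℕ} (n E B s : ℕ) (c : ℕ → ZMod m) : Set (ZMod m) :=
  (Set.range (usedPoint n E B s c))ᶜ

/-- A packing of `E` stars into a row `ℤ/m`. The star with centre `c e` has the differences
`N + 1`, for `N / n = e`, as long as `N < B`; the last star has `s` more leaves, which go to other
rows, and its centre is `0` if there are such leaves. The points in use are distinct, the numbers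
`±1, …, ±B` are distinct modulo `m`, and so are the doubles of the remaining points, which also avoid
the positions `-1, …, -s` of the leaves that come from other rows. -/
structure IsPacking {m : ℕ} (n E B s : ℕ) (c : ℕ → ZMod m) : Prop where
  count : B + s = E * n
  two_mul_lt : 2 * s < n + 1
  two_mul_lt' : 2 * B < m
  injective : Function.Injective (usedPoint n E B s c)
  centre : 0 < s → c (E - 1) = 0
  add_self_injOn : Set.InjOn (fun y => y + y) (freePoints n E B s c)
  add_self_ne : ∀ y ∈ freePoints n E B s c, ∀ d < s, y + y ≠ -((d + 1 : ℕ) : ZMod m)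

/-- The star class of a packing. Each row `p` has the `E` stars of the packing, whose leaves in
other rows are `-d` in row `p + d`; these positions are reflected in row `0`. Each remaining point
`y` gives a star with centre `-y` in row `0` and leaf `y` in all other rows. -/
def packingClass {m n : ℕ} (E B s : ℕ) (c : ℕ → ZMod m) :
    ((Fin E × Fin (n + 1)) ⊕ freePoints n E B s c) × Option (Fin n) → Point m n
  | (Sum.inl (e, p), none) => (rowSign p * c e, p)
  | (Sum.inl (e, p), some i) =>
    if e.1 * n + i.1 < B then (rowSign p * (c e + ((e.1 * n + i.1 + 1 : ℕ) : ZMod m)), p)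
    else (rowSign (p + Fin.ofNat (n + 1) (e.1 * n + i.1 - B + 1)) *
      -((e.1 * n + i.1 - B + 1 : ℕ) : ZMod m), p + Fin.ofNat (n + 1) (e.1 * n + i.1 - B + 1))
  | (Sum.inr y, none) => (-y.1, 0)
  | (Sum.inr y, some i) => (y.1, i.succ)

theorem ofNat_val {n d : ℕ} (hd : d ≤ n) : (Fin.ofNat (n + 1) d).val = d := by
  simp [Fin.ofNat, Nat.mod_eq_of_lt (Nat.lt_succ_of_le hd)]

theorem val_add_ofNat {n d : ℕ} (p : Fin (n + 1)) (hd : d ≤ n) :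
    (p + Fin.ofNat (n + 1) d).val =
      if n + 1 ≤ p.val + d then p.val + d - (n + 1) else p.val + d := by
  rw [Fin.val_add_eq_ite, ofNat_val hd]

theorem mul_add_inj {n a b i j : ℕ} (hi : i < n) (hj : j < n) (h : a * n + i = b * n + j) :
    a = b ∧ i = j := by
  have h1 := congrArg (· / n) h
  have hn : 0 < n := by omega
  simp only [Nat.mul_comm _ n, Nat.mul_add_div hn, Nat.div_eq_of_lt hi, Nat.div_eq_of_lt hj] at h1
  simp only [add_zero] at h1
  subst h1
  exact ⟨rfl, by omega⟩

section Packing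

variable {m n E B s : ℕ} {c : ℕ → ZMod m}

theorem IsPacking.card_freePoints [NeZero m] (h : IsPacking n E B s c) :
    (freePoints n E B s c).ncard + (E + B + s) = m := by
  have h1 := Set.ncard_add_ncard_compl (Set.range (usedPoint n E B s c))
  rw [← Set.image_univ, Set.ncard_image_of_injective _ h.injective, Set.ncard_univ,
    Nat.card_eq_fintype_card, Nat.card_eq_fintype_card, ZMod.card] at h1
  simp only [Fintype.card_sum, Fintype.card_fin] at h1
  rw [Set.image_univ] at h1
  unfold freePoints
  omega

theorem IsPacking.bijective [NeZero m] (h : IsPacking n E B s c) :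
    Function.Bijective (packingClass (n := n) E B s c) := by
  classical
  rw [Fintype.bijective_iff_surjective_and_card]
  constructor
  · rintro ⟨x, q⟩
    have hx : rowSign q * (rowSign q * x) = x := by rw [← mul_assoc, rowSign_mul_self, one_mul]
    by_cases hy : rowSign q * x ∈ freePoints n E B s c
    · by_cases hq : q = 0
      · subst hq
        refine ⟨(Sum.inr ⟨_, hy⟩, none), ?_⟩
        simp [packingClass, rowSign_zero]
      · obtain ⟨i, rfl⟩ := Fin.exists_succ_eq.2 hq
        refine ⟨(Sum.inr ⟨_, hy⟩, some i), ?_⟩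
        simp [packingClass, rowSign_of_ne hq]
    · obtain ⟨u, hu⟩ := not_not.1 hy
      rcases u with e | N | d
      · refine ⟨(Sum.inl (e, q), none), ?_⟩
        simp only [usedPoint] at hu
        simp [packingClass, hu, hx]
      · have hN := N.2
        have hc := h.count
        have hn : 0 < n := by
          rcases Nat.eq_zero_or_pos n with rfl | hn
          · simp at hc; omega
          · exact hn
        have hE : N.1 / n < E := by
          rw [Nat.div_lt_iff_lt_mul hn]; omega
        refine ⟨(Sum.inl (⟨_, hE⟩, q), some ⟨_, Nat.mod_lt N hn⟩), ?_⟩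
        simp only [usedPoint] at hu
        simp only [packingClass, Nat.div_add_mod', if_pos hN, hu, hx]
      · have hd := d.2
        have hc := h.count
        have ht := h.two_mul_lt
        have hn : 0 < n := by omega
        have hE : (B + d.1) / n < E := by
          rw [Nat.div_lt_iff_lt_mul hn]; omega
        refine ⟨(Sum.inl (⟨_, hE⟩, q - Fin.ofNat (n + 1) (d.1 + 1)),
          some ⟨_, Nat.mod_lt (B + d.1) hn⟩), ?_⟩
        have h1 : ¬ (B + d.1 < B) := by omega
        simp only [usedPoint] at hu
        simp only [packingClass, Nat.div_add_mod', if_neg h1, Nat.add_sub_cancel_left,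
          sub_add_cancel, hu, hx]
  · have h1 := h.card_freePoints
    have h2 := h.count
    rw [← Nat.card_coe_set_eq, Nat.card_eq_fintype_card] at h1
    simp only [Fintype.card_prod, Fintype.card_sum, Fintype.card_fin, Fintype.card_option,
      ZMod.card]
    congr 1
    rw [mul_add]
    omega

/-- The three kinds of arcs in the class of a packing. -/
theorem IsPacking.arc_cases (h : IsPacking n E B s c)
    (x : (Fin E × Fin (n + 1)) ⊕ freePoints n E B s c) (i : Fin n) :
    (∃ e p, x = Sum.inl (e, p) ∧ e.1 * n + i.1 < B ∧ (packingClass E B s c (x, none)).2 = p ∧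
      (packingClass E B s c (x, some i)).2 = p ∧
      (packingClass E B s c (x, some i)).1 - (packingClass E B s c (x, none)).1 =
        rowSign p * ((e.1 * n + i.1 + 1 : ℕ) : ZMod m)) ∨
    (∃ e p d, x = Sum.inl (e, p) ∧ d < s ∧ e.1 * n + i.1 = B + d ∧
      (packingClass E B s c (x, none)).2 = p ∧
      (packingClass E B s c (x, some i)).2 = p + Fin.ofNat (n + 1) (d + 1) ∧
      (packingClass E B s c (x, some i)).1 - (packingClass E B s c (x, none)).1 =
        rowSign (p + Fin.ofNat (n + 1) (d + 1)) * -((d + 1 : ℕ) : ZMod m)) ∨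
    (∃ y, x = Sum.inr y ∧ (packingClass E B s c (x, none)).2 = 0 ∧
      (packingClass E B s c (x, some i)).2 = i.succ ∧
      (packingClass E B s c (x, some i)).1 - (packingClass E B s c (x, none)).1 = y + y) := by
  rcases x with ⟨e, p⟩ | y
  · by_cases hN : e.1 * n + i.1 < B
    · refine Or.inl ⟨e, p, rfl, hN, rfl, ?_, ?_⟩
      · simp only [packingClass, if_pos hN]
      · simp only [packingClass, if_pos hN]
        ring
    · have hc := h.count
      have ht := h.two_mul_lt
      have hi := i.2
      have hlt : e.1 * n + i.1 < E * n := by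
        have : (e.1 + 1) * n ≤ E * n := Nat.mul_le_mul_right _ e.2
        rw [add_mul] at this
        omega
      have hle : E * n < (e.1 + 1 + 1) * n := by
        rw [add_mul, add_mul]; omega
      have he : e.1 = E - 1 := by
        have := Nat.lt_of_mul_lt_mul_right hle
        omega
      have hz : c e = 0 := by
        rw [he]
        exact h.centre (by omega)
      refine Or.inr (Or.inl ⟨e, p, e.1 * n + i.1 - B, rfl, by omega, by omega, rfl, ?_, ?_⟩)
      · simp only [packingClass, if_neg hN]
      · simp only [packingClass, if_neg hN, hz]
        ring
  · exact Or.inr (Or.inr ⟨y, rfl, rfl, rfl, by simp [packingClass]⟩)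

theorem IsPacking.isArc_iff (h : IsPacking n E B s c) (p q : Fin (n + 1)) (δ : ZMod m) :
    IsArc (fun _ : Unit => packingClass E B s c) p q δ ↔
      (p = q ∧ ∃ N < B, δ = rowSign p * ((N + 1 : ℕ) : ZMod m)) ∨
      (∃ d < s, q = p + Fin.ofNat (n + 1) (d + 1) ∧
        δ = rowSign q * -((d + 1 : ℕ) : ZMod m)) ∨
      (p = 0 ∧ q ≠ 0 ∧ ∃ y ∈ freePoints n E B s c, δ = y + y) := by
  constructor
  · rintro ⟨_, x, i, h1, h2, h3⟩
    rcases h.arc_cases x i with ⟨e, p', rfl, hN, h1', h2', h3'⟩ |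
      ⟨e, p', d, rfl, hd, hN, h1', h2', h3'⟩ | ⟨y, rfl, h1', h2', h3'⟩
    · exact Or.inl ⟨by rw [← h1, ← h2, h1', h2'], _, hN, by rw [← h3, h3', ← h1, h1']⟩
    · exact Or.inr (Or.inl ⟨d, hd, by rw [← h1, ← h2, h1', h2'], by rw [← h3, h3', ← h2, h2']⟩)
    · refine Or.inr (Or.inr ⟨by rw [← h1, h1'], ?_, y, y.2, by rw [← h3, h3']⟩)
      rw [← h2, h2']
      exact Fin.succ_ne_zero i
  · have hc := h.count
    have ht := h.two_mul_lt
    have key N (hN : N < E * n) : ∃ (e : Fin E) (i : Fin n), e.1 * n + i.1 = N := by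
      have hn : 0 < n := by
        rcases Nat.eq_zero_or_pos n with rfl | hn
        · simp at hN
        · exact hn
      exact ⟨⟨_, (Nat.div_lt_iff_lt_mul hn).2 hN⟩, ⟨_, Nat.mod_lt N hn⟩, Nat.div_add_mod' _ _⟩
    rintro (⟨rfl, N, hN, rfl⟩ | ⟨d, hd, rfl, rfl⟩ | ⟨rfl, hq, y, hy, rfl⟩)
    · obtain ⟨e, i, rfl⟩ := key N (by omega)
      refine ⟨(), Sum.inl (e, p), i, ?_⟩
      rcases h.arc_cases (Sum.inl (e, p)) i with ⟨e', p', he, hN, h1, h2, h3⟩ |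
        ⟨e', p', d, he, hd, hN', h1, h2, h3⟩ | ⟨y, he, h1', h2', h3'⟩
      · obtain ⟨rfl, rfl⟩ := Prod.mk.inj (Sum.inl.inj he)
        exact ⟨h1, h2, h3⟩
      · obtain ⟨rfl, rfl⟩ := Prod.mk.inj (Sum.inl.inj he)
        omega
      · exact absurd he (by simp)
    · obtain ⟨e, i, he⟩ := key (B + d) (by omega)
      refine ⟨(), Sum.inl (e, p), i, ?_⟩
      rcases h.arc_cases (Sum.inl (e, p)) i with ⟨e', p', he', hN, h1, h2, h3⟩ |
        ⟨e', p', d', he', hd, hN', h1, h2, h3⟩ | ⟨y, he', h1', h2', h3'⟩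
      · obtain ⟨rfl, rfl⟩ := Prod.mk.inj (Sum.inl.inj he')
        omega
      · obtain ⟨rfl, rfl⟩ := Prod.mk.inj (Sum.inl.inj he')
        obtain rfl : d = d' := by omega
        exact ⟨h1, h2, h3⟩
      · exact absurd he' (by simp)
    · obtain ⟨i, rfl⟩ := Fin.exists_succ_eq.2 hq
      exact ⟨(), Sum.inr ⟨y, hy⟩, i, rfl, rfl, by simp [packingClass]⟩

/-- Small positive numbers and their negatives are different modulo `m`. -/
theorem natCast_add_ne_zero {a b : ℕ} (ha : 0 < a) (h : a + b < m) :
    (a : ZMod m) + (b : ZMod m) ≠ 0 := by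
  intro h0
  rw [← Nat.cast_add, ZMod.natCast_eq_zero_iff] at h0
  exact absurd (Nat.le_of_dvd (by omega) h0) (by omega)

theorem natCast_inj_of_lt {a b : ℕ} (ha : a < m) (hb : b < m) (h : (a : ZMod m) = b) : a = b := by
  have := (ZMod.natCast_eq_natCast_iff' a b m).1 h
  rwa [Nat.mod_eq_of_lt ha, Nat.mod_eq_of_lt hb] at this

theorem add_ofNat_ne_self {d : ℕ} (p : Fin (n + 1)) (h0 : 0 < d) (hd : d ≤ n) :
    p + Fin.ofNat (n + 1) d ≠ p := by
  intro h
  have hp := p.2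
  have h1 := congrArg Fin.val h
  rw [val_add_ofNat p hd] at h1
  split_ifs at h1 <;> omega

theorem IsPacking.arc_inj (h : IsPacking n E B s c)
    (x : (Fin E × Fin (n + 1)) ⊕ freePoints n E B s c) (i : Fin n)
    (x' : (Fin E × Fin (n + 1)) ⊕ freePoints n E B s c) (i' : Fin n)
    (h1 : (packingClass E B s c (x, none)).2 = (packingClass E B s c (x', none)).2)
    (h2 : (packingClass E B s c (x, some i)).2 = (packingClass E B s c (x', some i')).2)
    (h3 : (packingClass E B s c (x, some i)).1 - (packingClass E B s c (x, none)).1 =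
      (packingClass E B s c (x', some i')).1 - (packingClass E B s c (x', none)).1) :
    x = x' ∧ i = i' := by
  have ht := h.two_mul_lt
  have hB := h.two_mul_lt'
  rcases h.arc_cases x i with ⟨e, p, rfl, hN, k1, k2, k3⟩ |
      ⟨e, p, d, rfl, hd, hN, k1, k2, k3⟩ | ⟨y, rfl, k1, k2, k3⟩ <;>
    rw [k1] at h1 <;> rw [k2] at h2 <;> rw [k3] at h3 <;>
    clear k1 k2 k3 <;>
    rcases h.arc_cases x' i' with ⟨e', p', rfl, hN', k1, k2, k3⟩ |
      ⟨e', p', d', rfl, hd', hN', k1, k2, k3⟩ | ⟨y', rfl, k1, k2, k3⟩ <;>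
    rw [k1] at h1 <;> rw [k2] at h2 <;> rw [k3] at h3 <;>
    clear k1 k2 k3
  · subst h1
    have := natCast_inj_of_lt (by omega) (by omega) (rowSign_mul_cancel h3)
    obtain ⟨he, hi⟩ := mul_add_inj i.2 i'.2 (Nat.succ_injective this)
    exact ⟨by rw [Fin.ext he], Fin.ext hi⟩
  · subst h1
    exact absurd h2.symm (add_ofNat_ne_self _ (by omega) (by omega))
  · exact absurd (h2.symm.trans h1) (Fin.succ_ne_zero _)
  · subst h1
    exact absurd h2 (add_ofNat_ne_self _ (by omega) (by omega))
  · subst h1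
    have := congrArg Fin.val h2
    have hp := p.2
    rw [val_add_ofNat _ (by omega), val_add_ofNat _ (by omega)] at this
    have hdd : d = d' := by split_ifs at this <;> omega
    subst hdd
    obtain ⟨he, hi⟩ := mul_add_inj i.2 i'.2 (hN.trans hN'.symm)
    exact ⟨by rw [Fin.ext he], Fin.ext hi⟩
  · rw [h2, rowSign_of_ne (Fin.succ_ne_zero _), one_mul] at h3
    exact absurd h3.symm (h.add_self_ne _ y'.2 d hd)
  · exact absurd (h2.trans h1.symm) (Fin.succ_ne_zero _)
  · rw [← h2, rowSign_of_ne (Fin.succ_ne_zero _), one_mul] at h3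
    exact absurd h3 (h.add_self_ne _ y.2 d' hd')
  · exact ⟨by rw [Subtype.ext (h.add_self_injOn y.2 y'.2 h3)], Fin.succ_injective _ h2⟩

theorem IsPacking.not_isArc_neg (h : IsPacking n E B s c) (p q : Fin (n + 1)) (δ : ZMod m)
    (h1 : IsArc (fun _ : Unit => packingClass E B s c) p q δ) :
    ¬ IsArc (fun _ : Unit => packingClass E B s c) q p (-δ) := by
  have ht := h.two_mul_lt
  have hB := h.two_mul_lt'
  rw [h.isArc_iff] at h1 ⊢
  rintro h2
  rcases h1 with ⟨rfl, N, hN, rfl⟩ | ⟨d, hd, rfl, rfl⟩ | ⟨rfl, hq, y, hy, rfl⟩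
  · rcases h2 with ⟨-, N', hN', h3⟩ | ⟨d, hd, h3, -⟩ | ⟨h3, h4, -⟩
    · rw [neg_eq_iff_add_eq_zero, ← mul_add] at h3
      have h4 := rowSign_mul_cancel (h3.trans (mul_zero (rowSign p)).symm)
      exact natCast_add_ne_zero (by omega) (by omega) h4
    · exact add_ofNat_ne_self p (by omega) (by omega) h3.symm
    · exact h4 h3
  · rcases h2 with ⟨h3, -⟩ | ⟨d', hd', h3, -⟩ | ⟨h3, h4, y, hy, h5⟩
    · exact add_ofNat_ne_self p (by omega) (by omega) h3
    · have := congrArg Fin.val h3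
      have hp := p.2
      rw [val_add_ofNat _ (by omega), val_add_ofNat _ (by omega)] at this
      split_ifs at this <;> omega
    · rw [h3, rowSign_zero] at h5
      exact h.add_self_ne y hy d hd (by rw [← h5]; ring)
  · rcases h2 with ⟨h3, -⟩ | ⟨d', hd', h3, h5⟩ | ⟨h3, -⟩
    · exact hq h3
    · rw [rowSign_zero] at h5
      exact h.add_self_ne y hy d' hd' (by rw [← neg_inj, h5]; ring)
    · exact hq h3

end Packing

/-! ### Decompositions from packings -/

theorem card_not_mem {m : ℕ} [NeZero m] (U : Set (ZMod m)) :
    Nat.card {δ // δ ∉ U} + U.ncard = m := by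
  have h := Set.ncard_add_ncard_compl U
  rw [Nat.card_eq_fintype_card, ZMod.card] at h
  have h' : Nat.card {δ // δ ∉ U} = Uᶜ.ncard := Nat.card_coe_set_eq Uᶜ
  omega

theorem half_cases {m B : ℕ} (hm : m ≤ 2 * B + 2) {δ : ZMod m} (hm0 : 0 < m) (hδ : δ ≠ 0) :
    (∃ N < B, δ = ((N + 1 : ℕ) : ZMod m)) ∨ (∃ N < B, -δ = ((N + 1 : ℕ) : ZMod m)) ∨
      (m = 2 * B + 2 ∧ δ = ((B + 1 : ℕ) : ZMod m)) := by
  have : NeZero m := ⟨hm0.ne'⟩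
  have h1 := ZMod.natCast_zmod_val δ
  have h2 := ZMod.val_lt δ
  have h3 : δ.val ≠ 0 := fun h => hδ ((ZMod.val_eq_zero δ).1 h)
  by_cases hB : δ.val ≤ B
  · exact Or.inl ⟨δ.val - 1, by omega, by rw [Nat.sub_add_cancel (by omega), h1]⟩
  · by_cases hB' : m - δ.val ≤ B
    · refine Or.inr (Or.inl ⟨m - δ.val - 1, by omega, ?_⟩)
      rw [Nat.sub_add_cancel (by omega), Nat.cast_sub h2.le, h1]
      simp
    · refine Or.inr (Or.inr ⟨by omega, ?_⟩)
      rw [← h1]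
      congr 1
      omega

theorem IsPacking.isArc_or_neg {m n E B s : ℕ} {c : ℕ → ZMod m} (h : IsPacking n E B s c)
    (hm : m ≤ 2 * B + 2) (p : Fin (n + 1)) {δ : ZMod m} (hδ : δ ≠ 0)
    (hδ' : ¬ (m = 2 * B + 2 ∧ δ = ((B + 1 : ℕ) : ZMod m))) :
    IsArc (fun _ : Unit => packingClass E B s c) p p δ ∨
      IsArc (fun _ : Unit => packingClass E B s c) p p (-δ) := by
  have hB := h.two_mul_lt'
  have hr : (rowSign p : ZMod m) = 1 ∨ (rowSign p : ZMod m) = -1 := by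
    unfold rowSign
    split_ifs <;> simp
  rw [h.isArc_iff, h.isArc_iff]
  rcases half_cases hm (by omega) hδ with ⟨N, hN, h1⟩ | ⟨N, hN, h1⟩ | h1
  · rcases hr with hr | hr
    · exact Or.inl (Or.inl ⟨rfl, N, hN, by rw [hr, one_mul, h1]⟩)
    · exact Or.inr (Or.inl ⟨rfl, N, hN, by rw [hr, neg_one_mul, h1]⟩)
  · rcases hr with hr | hr
    · exact Or.inr (Or.inl ⟨rfl, N, hN, by rw [hr, one_mul, h1]⟩)
    · exact Or.inl (Or.inl ⟨rfl, N, hN, by rw [hr, neg_one_mul, ← h1, neg_neg]⟩)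
  · exact absurd h1 hδ'

/-- With an even number of columns, the matching joins opposite points of the same row. -/
theorem IsPacking.existsURD_even {m n E B : ℕ} {c : ℕ → ZMod m} (h : IsPacking n E B 0 c)
    (hn : 0 < n) (hE : 0 < E) (hm : m = 2 * B + 2) :
    ∃ s, 1 ≤ s ∧ ExistsURD K₂ (nStar n) (m * (n + 1)) 1 s := by
  have : NeZero m := ⟨by omega⟩
  have hcard := h.card_freePoints
  have hinj := h.add_self_injOn
  set Y := freePoints n E B 0 c with hY
  have hhalf : (((B + 1 : ℕ) : ZMod m)) = -((B + 1 : ℕ) : ZMod m) := by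
    rw [eq_neg_iff_add_eq_zero, ← Nat.cast_add, ZMod.natCast_eq_zero_iff, hm]
    exact ⟨1, by ring⟩
  have hhalf0 : (((B + 1 : ℕ) : ZMod m)) ≠ 0 := fun h0 => by
    rw [ZMod.natCast_eq_zero_iff] at h0
    exact absurd (Nat.le_of_dvd (by omega) h0) (by omega)
  refine ⟨_, ?_, existsURD_of_differences hn (fun _ : Unit => packingClass E B 0 c)
    (fun _ => h.bijective) id (fun _ => ((B + 1 : ℕ) : ZMod m))
    (fun p => if p = 0 then B + 1 - Y.ncard else B + 1)
    (fun _ => rfl) (fun _ => hhalf) (fun _ _ => hhalf0) ?_ h.not_isArc_neg ?_ ?_ ?_⟩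
  · simp only [Fintype.card_sum, Fintype.card_prod, Fintype.card_unit, ZMod.card]
    omega
  · intro _ x i _ x' i' h1 h2 h3
    obtain ⟨rfl, rfl⟩ := h.arc_inj x i x' i' h1 h2 h3
    rfl
  · intro p
    rw [h.isArc_iff]
    rintro (⟨-, N, hN, h1⟩ | ⟨d, hd, -⟩ | ⟨rfl, h1, -⟩)
    · -- the involution `B + 1` of `ℤ/m` is none of `±1, …, ±B`
      unfold rowSign at h1
      split_ifs at h1
      · rw [neg_one_mul, eq_neg_iff_add_eq_zero] at h1
        exact natCast_add_ne_zero (by omega) (by omega) h1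
      · rw [one_mul] at h1
        have := natCast_inj_of_lt (by omega) (by omega) h1
        omega
    · omega
    · exact h1 rfl
  · intro p δ hδ
    by_cases hδ' : ((B + 1 : ℕ) : ZMod m) = δ
    · exact Or.inl ⟨rfl, hδ'⟩
    · exact Or.inr (h.isArc_or_neg hm.le p hδ fun h' => hδ' h'.2.symm)
  · intro p q hpq
    have hq : q ≠ 0 := by
      rintro rfl
      exact absurd hpq (Fin.not_lt_zero p)
    have key δ : (¬(id p = q ∧ ((B + 1 : ℕ) : ZMod m) = δ) ∧
        ¬ IsArc (fun _ : Unit => packingClass E B 0 c) p q δ ∧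
        ¬ IsArc (fun _ : Unit => packingClass E B 0 c) q p (-δ)) ↔
        δ ∉ {δ | p = 0 ∧ ∃ y ∈ Y, δ = y + y} := by
      rw [h.isArc_iff, h.isArc_iff]
      simp [hpq.ne, hpq.ne', hq, hY]
    simp only [key]
    have hc := card_not_mem {δ : ZMod m | p = 0 ∧ ∃ y ∈ Y, δ = y + y}
    by_cases hp : p = 0
    · have hU : {δ : ZMod m | p = 0 ∧ ∃ y ∈ Y, δ = y + y} = (fun y => y + y) '' Y := by
        ext δ
        simp [hp, eq_comm]
      rw [hU, hinj.ncard_image] at hc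
      rw [hU, if_pos hp, if_neg hq]
      omega
    · have hU : {δ : ZMod m | p = 0 ∧ ∃ y ∈ Y, δ = y + y} = ∅ := by
        ext δ
        simp [hp]
      rw [hU, Set.ncard_empty] at hc
      rw [hU, if_neg hp, if_neg hq]
      omega

/-- With an odd number of columns, the matching joins points of the same column, in opposite
rows. -/
theorem IsPacking.existsURD_odd {m n h E B : ℕ} {c : ℕ → ZMod m}
    (hP : IsPacking n E B (h - 1) c) (hn : n + 1 = 2 * h) (hh : 2 ≤ h) (hE : 0 < E)
    (hm : m = 2 * B + 1) :
    ∃ s, 1 ≤ s ∧ ExistsURD K₂ (nStar n) (m * (n + 1)) 1 s := by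
  have : NeZero m := ⟨by omega⟩
  have hcard := hP.card_freePoints
  have hinj := hP.add_self_injOn
  have h0 : (0 : ZMod m) ∉ freePoints n E B (h - 1) c := by
    rw [← hP.centre (by omega)]
    exact fun h' => h' ⟨Sum.inl ⟨E - 1, by omega⟩, rfl⟩
  have hadd0 : ∀ y ∈ freePoints n E B (h - 1) c, y + y ≠ 0 := by
    intro y hy hyy
    have h2 : ((2 * B + 1 : ℕ) : ZMod m) = 0 := by rw [← hm]; simp
    push_cast at h2
    have : y = 0 := by linear_combination y * h2 - (B : ZMod m) * hyy
    exact h0 (this ▸ hy)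
  have hval (p : Fin (n + 1)) : (p + Fin.ofNat (n + 1) h).val =
      if h ≤ p.val then p.val - h else p.val + h := by
    rw [val_add_ofNat p (by omega)]
    split_ifs <;> omega
  have hinv (p : Fin (n + 1)) : p + Fin.ofNat (n + 1) h + Fin.ofNat (n + 1) h = p := by
    ext
    rw [hval, hval]
    have := p.2
    split_ifs <;> omega
  set Y := freePoints n E B (h - 1) c with hY
  refine ⟨_, ?_, existsURD_of_differences (by omega) (fun _ : Unit => packingClass E B (h - 1) c)
    (fun _ => hP.bijective) (fun p => p + Fin.ofNat (n + 1) h) (fun _ => 0)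
    (fun p => if p = 0 then B - Y.ncard else B)
    hinv (by simp) (fun p hp => absurd hp (add_ofNat_ne_self p (by omega) (by omega)))
    ?_ hP.not_isArc_neg ?_ ?_ ?_⟩
  · simp only [Fintype.card_sum, Fintype.card_prod, Fintype.card_unit, ZMod.card]
    omega
  · intro _ x i _ x' i' h1 h2 h3
    obtain ⟨rfl, rfl⟩ := hP.arc_inj x i x' i' h1 h2 h3
    rfl
  · intro p
    rw [hP.isArc_iff]
    rintro (⟨h1, -⟩ | ⟨d, hd, h1, -⟩ | ⟨-, -, y, hy, h1⟩)
    · exact add_ofNat_ne_self p (by omega) (by omega) h1.symm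
    · have h2 := congrArg Fin.val h1
      have hp := p.2
      rw [hval, val_add_ofNat _ (by omega)] at h2
      split_ifs at h2 <;> omega
    · exact hadd0 y hy h1.symm
  · intro p δ hδ
    exact Or.inr (hP.isArc_or_neg (by omega) p hδ (by omega))
  · intro p q hpq
    have hq : q ≠ 0 := by
      rintro rfl
      exact absurd hpq (Fin.not_lt_zero p)
    have hlt : p.val < q.val := hpq
    have hq2 := q.2
    have hr : (rowSign q : ZMod m) = 1 := rowSign_of_ne hq
    have e1 d (hd : d < h) : q = p + Fin.ofNat (n + 1) (d + 1) ↔ d + 1 = q.val - p.val := by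
      rw [Fin.ext_iff, val_add_ofNat _ (by omega)]
      split_ifs <;> omega
    have e2 d (hd : d < h) :
        p = q + Fin.ofNat (n + 1) (d + 1) ↔ d + 1 = n + 1 - (q.val - p.val) := by
      rw [Fin.ext_iff, val_add_ofNat _ (by omega)]
      split_ifs <;> omega
    have e3 : p + Fin.ofNat (n + 1) h = q ↔ q.val - p.val = h := by
      rw [Fin.ext_iff, hval]
      split_ifs <;> omega
    -- besides the differences `y + y`, exactly one difference is taken between two rows
    obtain ⟨b, hb0, hb⟩ : ∃ b : ZMod m, (p = 0 → ∀ y ∈ Y, y + y ≠ b) ∧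
        ∀ δ, ((p + Fin.ofNat (n + 1) h = q ∧ 0 = δ) ∨
          (∃ d < h - 1, q = p + Fin.ofNat (n + 1) (d + 1) ∧
            δ = rowSign q * -((d + 1 : ℕ) : ZMod m)) ∨
          (∃ d < h - 1, p = q + Fin.ofNat (n + 1) (d + 1) ∧
            -δ = rowSign p * -((d + 1 : ℕ) : ZMod m))) ↔ δ = b := by
      rcases lt_trichotomy (q.val - p.val) h with hk | hk | hk
      · refine ⟨-((q.val - p.val - 1 + 1 : ℕ) : ZMod m), fun _ y hy =>
          hP.add_self_ne y hy _ (by omega), fun δ => ⟨?_, ?_⟩⟩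
        · rintro (⟨h1, -⟩ | ⟨d, hd, h1, rfl⟩ | ⟨d, hd, h1, -⟩)
          · rw [e3] at h1; omega
          · rw [e1 d (by omega)] at h1
            rw [hr, one_mul, ← h1, Nat.add_sub_cancel]
          · rw [e2 d (by omega)] at h1; omega
        · rintro rfl
          refine Or.inr (Or.inl ⟨q.val - p.val - 1, by omega, ?_, by rw [hr, one_mul]⟩)
          rw [e1 _ (by omega)]; omega
      · refine ⟨0, fun _ => hadd0, fun δ => ⟨?_, ?_⟩⟩
        · rintro (⟨-, rfl⟩ | ⟨d, hd, h1, -⟩ | ⟨d, hd, h1, -⟩)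
          · rfl
          · rw [e1 d (by omega)] at h1; omega
          · rw [e2 d (by omega)] at h1; omega
        · rintro rfl
          exact Or.inl ⟨e3.2 hk, rfl⟩
      · refine ⟨rowSign p * ((n + 1 - (q.val - p.val) - 1 + 1 : ℕ) : ZMod m), ?_,
          fun δ => ⟨?_, ?_⟩⟩
        · rintro rfl y hy
          rw [rowSign_zero, neg_one_mul]
          exact hP.add_self_ne y hy _ (by omega)
        · rintro (⟨h1, -⟩ | ⟨d, hd, h1, -⟩ | ⟨d, hd, h1, h2⟩)
          · rw [e3] at h1; omega
          · rw [e1 d (by omega)] at h1; omega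
          · rw [e2 d (by omega)] at h1
            rw [← h1, Nat.add_sub_cancel, ← neg_neg δ, h2]
            ring
        · rintro rfl
          refine Or.inr (Or.inr ⟨n + 1 - (q.val - p.val) - 1, by omega, ?_, by ring⟩)
          rw [e2 _ (by omega)]; omega
    have key δ : (¬(p + Fin.ofNat (n + 1) h = q ∧ 0 = δ) ∧
        ¬ IsArc (fun _ : Unit => packingClass E B (h - 1) c) p q δ ∧
        ¬ IsArc (fun _ : Unit => packingClass E B (h - 1) c) q p (-δ)) ↔
        δ ∉ insert b {δ | p = 0 ∧ ∃ y ∈ Y, δ = y + y} := by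
      rw [Set.mem_insert_iff, ← hb, hP.isArc_iff, hP.isArc_iff]
      have taut : ∀ a b c d : Prop, (¬a ∧ ¬(b ∨ d) ∧ ¬c) ↔ ¬((a ∨ b ∨ c) ∨ d) := by
        intro a b c d; tauto
      simp only [hpq.ne, hpq.ne', hq, ← hY, Set.mem_ofPred_eq, false_and, false_or, ne_eq,
        not_false_eq_true, true_and, or_false]
      exact taut _ _ _ _
    simp only [key]
    have hc := card_not_mem (insert b {δ : ZMod m | p = 0 ∧ ∃ y ∈ Y, δ = y + y})
    rw [Set.ncard_insert_of_notMem (by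
      rintro ⟨hp, y, hy, hyb⟩
      exact hb0 hp y hy hyb.symm)] at hc
    by_cases hp : p = 0
    · have hU : {δ : ZMod m | p = 0 ∧ ∃ y ∈ Y, δ = y + y} = (fun y => y + y) '' Y := by
        ext δ
        simp [hp, eq_comm]
      rw [hU, hinj.ncard_image] at hc
      rw [hU, if_pos hp, if_neg hq]
      omega
    · have hU : {δ : ZMod m | p = 0 ∧ ∃ y ∈ Y, δ = y + y} = ∅ := by
        ext δ
        simp [hp]
      rw [hU, Set.ncard_empty] at hc
      rw [hU, if_neg hp, if_neg hq]
      omega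

/-- With two columns, translation invariant classes suffice, one centred on each row. -/
theorem existsURD_two_columns {n : ℕ} (hn : 0 < n) :
    ∃ s, 1 ≤ s ∧ ExistsURD K₂ (nStar n) (2 * (n + 1)) 1 s := by
  have hno (p q : Fin (n + 1)) (δ : ZMod 2) :
      ¬ IsArc (fun i : Empty => (i.elim : Empty × Option (Fin n) → Point 2 n)) p q δ := by
    rintro ⟨i, -⟩
    exact i.elim
  refine ⟨_, ?_, existsURD_of_differences hn
    (fun i : Empty => (i.elim : Empty × Option (Fin n) → Point 2 n)) (fun i => i.elim)
    id (fun _ => 1) (fun _ => 1) (fun _ => rfl) (fun _ => by decide) (fun _ _ => by decide)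
    (fun i => i.elim) (fun p q δ h => absurd h (hno _ _ _)) (fun _ => hno _ _ _) ?_ ?_⟩
  · simp
  · intro p δ hδ
    refine Or.inl ⟨rfl, ?_⟩
    revert δ
    decide
  · intro p q hpq
    simp [hno, hpq.ne]

/-! ### The packings -/

/-- The centre of the star with the differences `e * n + 1, …, e * n + n`, as an integer of
absolute value at most `t * n + k`. Of the stars number `t - 1, t - 2, …, 0`, every other one is
placed in the interval from `-(t * n + k)` to `-k`, and the remaining ones in the interval from `1`
to `t * n`; in both intervals, the centres follow one another from the left end on, and the leaves
accumulate at the right end. The star number `t` has centre `0`. -/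
def centre (n t k e : ℕ) : ℤ :=
  if e = t then 0
  else if (t - 1 - e) % 2 = 0 then -(t * n + k : ℤ) + ((t - 1 - e) / 2 : ℕ)
  else 1 + ((t - 1 - e) / 2 : ℕ)

/-- The points of a row that are taken by the stars with centres `centre n t k e`, as integers. -/
def usedInt (n t k E B s : ℕ) : Fin E ⊕ Fin B ⊕ Fin s → ℤ
  | Sum.inl e => centre n t k e
  | Sum.inr (Sum.inl N) => centre n t k (N / n) + (N + 1)
  | Sum.inr (Sum.inr d) => -(d + 1)

theorem usedPoint_eq_cast (m n t k E B s : ℕ) (u : Fin E ⊕ Fin B ⊕ Fin s) :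
    usedPoint n E B s (fun e => ((centre n t k e : ℤ) : ZMod m)) u =
      (usedInt n t k E B s u : ZMod m) := by
  rcases u with e | N | d <;> simp [usedPoint, usedInt]

theorem centre_of_even {n t k e a : ℕ} (h : e + 1 + 2 * a = t) :
    centre n t k e = -(t * n + k : ℤ) + a := by
  have h1 : e ≠ t := by omega
  have h2 : t - 1 - e = 2 * a := by omega
  simp [centre, h1, h2]

theorem centre_of_odd {n t k e a : ℕ} (h : e + 1 + (2 * a + 1) = t) :
    centre n t k e = 1 + a := by
  have h1 : e ≠ t := by omega
  have h2 : t - 1 - e = 2 * a + 1 := by omega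
  have h3 : (2 * a + 1) / 2 = a := by omega
  simp [centre, h1, h2, h3]

theorem centre_self {n t k : ℕ} : centre n t k t = 0 := by simp [centre]

/-- The position of a centre. -/
theorem centre_cases {n t k e : ℕ} (he : e ≤ t) :
    (∃ a, e + 1 + 2 * a = t ∧ centre n t k e = -(t * n + k : ℤ) + a) ∨
    (∃ a, e + 1 + (2 * a + 1) = t ∧ centre n t k e = 1 + a) ∨ (e = t ∧ centre n t k e = 0) := by
  rcases he.eq_or_lt with rfl | he
  · exact Or.inr (Or.inr ⟨rfl, centre_self⟩)
  · rcases Nat.even_or_odd' (t - 1 - e) with ⟨a, ha | ha⟩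
    · have h : e + 1 + 2 * a = t := by omega
      exact Or.inl ⟨a, h, centre_of_even h⟩
    · have h : e + 1 + (2 * a + 1) = t := by omega
      exact Or.inr (Or.inl ⟨a, h, centre_of_odd h⟩)

/-- The leaf number `u` from the right, of the star number `a` in the left interval. -/
theorem leaf_of_even {n t k q a u : ℕ} (hq : q + 1 = 2 * n) (hu : u < n) (ha : 2 * a + 1 ≤ t) :
    ∃ N, N + 1 + 2 * (a * n) + u = t * n ∧
      centre n t k (N / n) + (N + 1) = -(k : ℤ) - (a * q + u : ℕ) := by
  obtain ⟨e, he⟩ : ∃ e, e + 1 + 2 * a = t := ⟨t - 1 - 2 * a, by omega⟩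
  have hn : 0 < n := by omega
  have hN : (e * n + (n - 1 - u)) / n = e := by
    rw [mul_comm, Nat.mul_add_div hn, Nat.div_eq_of_lt (by omega), add_zero]
  have h1 : e * n + n + 2 * (a * n) = t * n := by rw [← he]; ring
  have h2 : a * q + a = 2 * (a * n) := by rw [← Nat.mul_succ, Nat.succ_eq_add_one, hq]; ring
  refine ⟨e * n + (n - 1 - u), by omega, ?_⟩
  rw [hN, centre_of_even he]
  zify at h1 h2
  push_cast [Nat.cast_sub (show u ≤ n - 1 by omega), Nat.cast_sub (show 1 ≤ n by omega)]
  linarith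

/-- The leaf number `u` from the right, of the star number `a` in the right interval. -/
theorem leaf_of_odd {n t k q a u : ℕ} (hq : q + 1 = 2 * n) (hu : u < n) (ha : 2 * a + 2 ≤ t) :
    ∃ N, N + 1 + (2 * (a * n) + n) + u = t * n ∧
      centre n t k (N / n) + (N + 1) = 1 + (t * n : ℕ) - n - (a * q + u : ℕ) := by
  obtain ⟨e, he⟩ : ∃ e, e + 1 + (2 * a + 1) = t := ⟨t - 1 - (2 * a + 1), by omega⟩
  have hn : 0 < n := by omega
  have hN : (e * n + (n - 1 - u)) / n = e := by
    rw [mul_comm, Nat.mul_add_div hn, Nat.div_eq_of_lt (by omega), add_zero]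
  have h1 : e * n + n + (2 * (a * n) + n) = t * n := by rw [← he]; ring
  have h2 : a * q + a = 2 * (a * n) := by rw [← Nat.mul_succ, Nat.succ_eq_add_one, hq]; ring
  refine ⟨e * n + (n - 1 - u), by omega, ?_⟩
  rw [hN, centre_of_odd he]
  zify at h1 h2
  push_cast [Nat.cast_sub (show u ≤ n - 1 by omega), Nat.cast_sub (show 1 ≤ n by omega)]
  linarith

/-- The position of a leaf. In both intervals the leaves of each star form a block of `n` points,
and consecutive blocks are `2 * n - 1` points apart. -/
theorem leaf_cases {n t k q N : ℕ} (hq : q + 1 = 2 * n) (hk : k ≤ n) (hN : N < t * n + k) :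
    (∃ a u, u < n ∧ 2 * a + 1 ≤ t ∧ N + 1 + 2 * (a * n) + u = t * n ∧
      centre n t k (N / n) + (N + 1) = -(k : ℤ) - (a * q + u : ℕ)) ∨
    (∃ a u, u < n ∧ 2 * a + 2 ≤ t ∧ N + 1 + (2 * (a * n) + n) + u = t * n ∧
      centre n t k (N / n) + (N + 1) = 1 + (t * n : ℕ) - n - (a * q + u : ℕ)) ∨
    (t * n ≤ N ∧ centre n t k (N / n) + (N + 1) = N + 1) := by
  have hn : 0 < n := by omega
  have hdiv := Nat.div_add_mod' N n
  have hmod := Nat.mod_lt N hn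
  by_cases hNt : N < t * n
  · have he : N / n < t := (Nat.div_lt_iff_lt_mul hn).2 hNt
    obtain ⟨e, hE⟩ : ∃ e, N / n = e := ⟨_, rfl⟩
    rw [hE] at hdiv he
    rcases Nat.even_or_odd' (t - 1 - e) with ⟨a, ha | ha⟩
    · obtain ⟨N', h1, h2⟩ := leaf_of_even (k := k) hq (show n - 1 - N % n < n by omega)
        (show 2 * a + 1 ≤ t by omega)
      have h3 : e * n + n + 2 * (a * n) = t * n := by
        rw [show t = e + 1 + 2 * a by omega]; ring
      obtain rfl : N = N' := by omega
      exact Or.inl ⟨a, _, by omega, by omega, h1, h2⟩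
    · obtain ⟨N', h1, h2⟩ := leaf_of_odd (k := k) hq (show n - 1 - N % n < n by omega)
        (show 2 * a + 2 ≤ t by omega)
      have h3 : e * n + n + (2 * (a * n) + n) = t * n := by
        rw [show t = e + 1 + (2 * a + 1) by omega]; ring
      obtain rfl : N = N' := by omega
      exact Or.inr (Or.inl ⟨a, _, by omega, by omega, h1, h2⟩)
  · refine Or.inr (Or.inr ⟨by omega, ?_⟩)
    have he : N / n = t := by
      rw [Nat.div_eq_iff hn]
      constructor <;> omega
    rw [he, centre_self, zero_add]

/-- The leaves of the left interval lie above its centres. -/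
theorem even_block_le {n t q a u : ℕ} (hq : q + 1 = 2 * n) (hu : u < n) (ha : 2 * a + 1 ≤ t) :
    2 * (a * q + u) + t + 2 ≤ 2 * (t * n) + 1 := by
  have h1 := Nat.mul_le_mul_right q ha
  have h2 : t * q + t = 2 * (t * n) := by rw [← Nat.mul_succ, Nat.succ_eq_add_one, hq]; ring
  rw [add_mul, mul_assoc] at h1
  omega

/-- The leaves of the right interval lie above its centres. -/
theorem odd_block_le {n t q a u : ℕ} (hq : q + 1 = 2 * n) (hu : u < n) (ha : 2 * a + 2 ≤ t) :
    2 * (a * q + u) + 2 * n + t ≤ 2 * (t * n) := by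
  have h1 := Nat.mul_le_mul_right q ha
  have h2 : t * q + t = 2 * (t * n) := by rw [← Nat.mul_succ, Nat.succ_eq_add_one, hq]; ring
  rw [add_mul, mul_assoc] at h1
  omega

theorem usedInt_injective {n t k E s : ℕ} (hn : 0 < n) (hk : k ≤ n) (hs : s ≤ k - 1)
    (hE : E ≤ t + 1) (hE' : k = 0 → E ≤ t) :
    Function.Injective (usedInt n t k E (t * n + k) s) := by
  obtain ⟨q, hq⟩ : ∃ q, q + 1 = 2 * n := ⟨2 * n - 1, by omega⟩
  have htn : t ≤ t * n := Nat.le_mul_of_pos_right _ hn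
  -- The pieces are disjoint because they follow one another in this order: centres and leaves of
  -- the left interval, leaves from other rows, `0`, centres and leaves of the right interval, and
  -- the leaves of `0`.
  have hc (e : Fin E) : (∃ a, e.1 + 1 + 2 * a = t ∧ centre n t k e = -(t * n : ℕ) - k + a) ∨
      (∃ a, e.1 + 1 + (2 * a + 1) = t ∧ centre n t k e = 1 + a) ∨
      (e.1 = t ∧ 0 < k ∧ centre n t k e = 0) := by
    have he := e.2
    rcases centre_cases (n := n) (k := k) (show e.1 ≤ t by omega) with ⟨a, h1, h2⟩ | h | ⟨h1, h2⟩
    · exact Or.inl ⟨a, h1, by rw [h2]; push_cast; ring⟩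
    · exact Or.inr (Or.inl h)
    · exact Or.inr (Or.inr ⟨h1, by omega, h2⟩)
  have hl (N : Fin (t * n + k)) :
      (∃ a u, u < n ∧ 2 * a + 1 ≤ t ∧ N.1 + 1 + 2 * (a * n) + u = t * n ∧
        2 * (a * q + u) + t + 2 ≤ 2 * (t * n) + 1 ∧
        centre n t k (N / n) + (N + 1) = -(k : ℤ) - (a * q + u : ℕ)) ∨
      (∃ a u, u < n ∧ 2 * a + 2 ≤ t ∧ N.1 + 1 + (2 * (a * n) + n) + u = t * n ∧
        2 * (a * q + u) + 2 * n + t ≤ 2 * (t * n) ∧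
        centre n t k (N / n) + (N + 1) = 1 + (t * n : ℕ) - n - (a * q + u : ℕ)) ∨
      (t * n ≤ N.1 ∧ centre n t k (N / n) + (N + 1) = N + 1) := by
    rcases leaf_cases hq hk N.2 with ⟨a, u, h1, h2, h3, h4⟩ | ⟨a, u, h1, h2, h3, h4⟩ | h
    · exact Or.inl ⟨a, u, h1, h2, h3, even_block_le hq h1 h2, h4⟩
    · exact Or.inr (Or.inl ⟨a, u, h1, h2, h3, odd_block_le hq h1 h2, h4⟩)
    · exact Or.inr (Or.inr h)
  have hcl (e : Fin E) (N : Fin (t * n + k)) :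
      centre n t k e ≠ centre n t k (N / n) + (N + 1) := by
    rcases hc e with ⟨a, h1, h2⟩ | ⟨a, h1, h2⟩ | ⟨h1, h0, h2⟩ <;>
    rcases hl N with ⟨a', u, h3, h4, h5, h6, h7⟩ | ⟨a', u, h3, h4, h5, h6, h7⟩ | ⟨h3, h7⟩ <;>
    rw [h2, h7] <;> omega
  have hcd (e : Fin E) (d : Fin s) : centre n t k e ≠ -(d + 1) := by
    have hd := d.2
    rcases hc e with ⟨a, h1, h2⟩ | ⟨a, h1, h2⟩ | ⟨h1, h0, h2⟩ <;> rw [h2] <;> omega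
  have hld (N : Fin (t * n + k)) (d : Fin s) : centre n t k (N / n) + (N + 1) ≠ -(d + 1) := by
    have hd := d.2
    rcases hl N with ⟨a', u, h3, h4, h5, h6, h7⟩ | ⟨a', u, h3, h4, h5, h6, h7⟩ | ⟨h3, h7⟩ <;>
    rw [h7] <;> omega
  rintro (e | N | d) (e' | N' | d') h <;> simp only [usedInt] at h
  · have he : e.1 = e'.1 := by
      rcases hc e with ⟨a, h1, h2⟩ | ⟨a, h1, h2⟩ | ⟨h1, h0, h2⟩ <;>
      rcases hc e' with ⟨a', h1', h2'⟩ | ⟨a', h1', h2'⟩ | ⟨h1', h0', h2'⟩ <;>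
      rw [h2, h2'] at h <;> omega
    rw [Fin.ext he]
  · exact absurd h (hcl _ _)
  · exact absurd h (hcd _ _)
  · exact absurd h.symm (hcl _ _)
  · have he : N.1 = N'.1 := by
      rcases hl N with ⟨a, u, h1, h2, h3, h4, h5⟩ | ⟨a, u, h1, h2, h3, h4, h5⟩ | ⟨h3, h5⟩ <;>
      rcases hl N' with ⟨a', u', h1', h2', h3', h4', h5'⟩ | ⟨a', u', h1', h2', h3', h4', h5'⟩ |
        ⟨h3', h5'⟩ <;>
      rw [h5, h5'] at h
      · obtain ⟨rfl, rfl⟩ := mul_add_inj (n := q) (i := u) (j := u') (by omega) (by omega)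
          (show a * q + u = a' * q + u' by omega)
        omega
      · omega
      · omega
      · omega
      · obtain ⟨rfl, rfl⟩ := mul_add_inj (n := q) (i := u) (j := u') (by omega) (by omega)
          (show a * q + u = a' * q + u' by omega)
        omega
      · omega
      · omega
      · omega
      · omega
    rw [Fin.ext he]
  · exact absurd h (hld _ _)
  · exact absurd h.symm (hcd _ _)
  · exact absurd h.symm (hld _ _)
  · have he : d.1 = d'.1 := by omega
    rw [Fin.ext he]

theorem abs_usedInt_le {n t k E s : ℕ} (hn : 0 < n) (hk : k ≤ n) (hs : s ≤ k - 1)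
    (hE : E ≤ t + 1) (u : Fin E ⊕ Fin (t * n + k) ⊕ Fin s) :
    |usedInt n t k E (t * n + k) s u| ≤ (t * n + k : ℕ) := by
  obtain ⟨q, hq⟩ : ∃ q, q + 1 = 2 * n := ⟨2 * n - 1, by omega⟩
  have htn : t ≤ t * n := Nat.le_mul_of_pos_right _ hn
  rw [abs_le]
  rcases u with e | N | d <;> simp only [usedInt]
  · have he := e.2
    rcases centre_cases (n := n) (k := k) (show e.1 ≤ t by omega) with ⟨a, h1, h2⟩ | ⟨a, h1, h2⟩ |
      ⟨h1, h2⟩ <;> rw [h2] <;> push_cast <;> constructor <;> omega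
  · rcases leaf_cases hq hk N.2 with ⟨a, u, h1, h2, h3, h4⟩ | ⟨a, u, h1, h2, h3, h4⟩ | ⟨h1, h4⟩ <;>
      rw [h4]
    · have := even_block_le hq h1 h2
      constructor <;> omega
    · have := odd_block_le hq h1 h2
      constructor <;> omega
    · have := N.2
      constructor <;> omega
  · have hd := d.2
    constructor <;> omega

theorem intCast_inj_of_abs_le {m K : ℕ} (hm : 2 * K < m) {x y : ℤ} (hx : |x| ≤ K) (hy : |y| ≤ K)
    (h : (x : ZMod m) = y) : x = y := by
  rw [ZMod.intCast_eq_intCast_iff_dvd_sub] at h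
  have h1 := abs_le.1 hx
  have h2 := abs_le.1 hy
  have := Int.eq_zero_of_abs_lt_dvd h (by rw [abs_lt]; constructor <;> omega)
  omega

theorem usedPoint_injective {m n t k E s : ℕ} (hn : 0 < n) (hk : k ≤ n) (hs : s ≤ k - 1)
    (hE : E ≤ t + 1) (hE' : k = 0 → E ≤ t) (hm : 2 * (t * n + k) < m) :
    Function.Injective
      (usedPoint n E (t * n + k) s (fun e => ((centre n t k e : ℤ) : ZMod m))) := by
  intro u u' h
  rw [usedPoint_eq_cast, usedPoint_eq_cast] at h
  exact usedInt_injective hn hk hs hE hE' (intCast_inj_of_abs_le hm (abs_usedInt_le hn hk hs hE u)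
    (abs_usedInt_le hn hk hs hE u') h)

theorem isPacking_odd {m n h t : ℕ} (hn : n + 1 = 2 * h) (hh : 2 ≤ h)
    (hm : m = 2 * (t * n + h) + 1) :
    IsPacking n (t + 1) (t * n + h) (h - 1) (fun e => ((centre n t h e : ℤ) : ZMod m)) where
  count := by rw [add_mul]; omega
  two_mul_lt := by omega
  two_mul_lt' := by omega
  injective := usedPoint_injective (by omega) (by omega) le_rfl le_rfl (by omega) (by omega)
  centre _ := by simp [centre_self]
  add_self_injOn := by
    intro y _ y' _ hy
    have hy : y + y = y' + y' := hy
    have h2 : ((2 * (t * n + h) + 1 : ℕ) : ZMod m) = 0 := by rw [← hm]; simp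
    rw [Nat.cast_add, Nat.cast_mul] at h2
    push_cast at h2
    linear_combination (y - y') * h2 - ((t : ZMod m) * n + h) * hy
  add_self_ne := by
    have : NeZero m := ⟨by omega⟩
    intro y hy d hd h0
    have hz := ZMod.valMinAbs_mem_Ioc y
    have hzy := ZMod.coe_valMinAbs y
    set z := y.valMinAbs with hzdef
    rw [← hzy, eq_neg_iff_add_eq_zero, ← Int.cast_natCast, ← Int.cast_add, ← Int.cast_add,
      ZMod.intCast_zmod_eq_zero_iff_dvd] at h0
    obtain ⟨hz1, hz2⟩ := hz
    obtain ⟨j, hj⟩ := h0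
    have hused (u) : usedInt n t h (t + 1) (t * n + h) (h - 1) u ≠ z := by
      intro hu
      exact hy ⟨u, by rw [usedPoint_eq_cast, hu, hzy]⟩
    have hmB : (m : ℤ) = 2 * ((t * n : ℕ) + h) + 1 := by rw [hm]; push_cast; ring
    -- modulo `m`, `2 z = -(d + 1)` has only the solutions `-(d + 1) / 2`, the position of a leaf
    -- from another row, and `t * n + h - d / 2`, a leaf of the centre `0`
    obtain rfl | rfl : j = 0 ∨ j = 1 := by
      have h1 : -1 < j := by
        by_contra hlt
        have : (m : ℤ) * j ≤ m * (-1) := mul_le_mul_of_nonneg_left (by omega) (by omega)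
        omega
      have h2 : j < 2 := by
        by_contra hlt
        have : (m : ℤ) * 2 ≤ m * j := mul_le_mul_of_nonneg_left (by omega) (by omega)
        omega
      omega
    · refine hused (Sum.inr (Sum.inr ⟨(d + 1) / 2 - 1, by omega⟩)) ?_
      simp only [usedInt]
      omega
    · have hN : (t * n + (h - 1 - d / 2)) / n = t := by
        rw [mul_comm, Nat.mul_add_div (by omega), Nat.div_eq_of_lt (by omega), add_zero]
      refine hused (Sum.inr (Sum.inl ⟨t * n + (h - 1 - d / 2), by omega⟩)) ?_
      simp only [usedInt, hN, centre_self]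
      omega

/-- Of two integers that are opposite modulo `2 * (t * n + 1)`, at least one is taken: the gaps
between the leaves in one interval are opposite to the blocks of leaves in the other one. -/
theorem exists_usedInt_eq {n t : ℕ} (hn : 0 < n) (ht : 0 < t) {z : ℤ} (hz : 1 ≤ z)
    (hz' : z ≤ (t * n : ℕ) + 1) :
    ∃ u, usedInt n t 0 t (t * n) 0 u = z ∨ usedInt n t 0 t (t * n) 0 u = z - ((t * n : ℕ) + 1) := by
  obtain ⟨q, hq⟩ : ∃ q, q + 1 = 2 * n := ⟨2 * n - 1, by omega⟩
  obtain ⟨w, hw⟩ : ∃ w : ℕ, (w : ℤ) = (t * n : ℕ) + 1 - z := ⟨((t * n : ℕ) + 1 - z).toNat, by omega⟩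
  have hq0 : 0 < q := by omega
  have hdiv := Nat.div_add_mod' w q
  have hmod := Nat.mod_lt w hq0
  set a := w / q
  set r := w % q
  have h2 : t * q + t = 2 * (t * n) := by rw [← Nat.mul_succ, Nat.succ_eq_add_one, hq]; ring
  have even_leaf a u (hu : u < n) (ha : 2 * a + 1 ≤ t) :
      ∃ v, usedInt n t 0 t (t * n) 0 v = - ((a * q + u : ℕ) : ℤ) := by
    obtain ⟨N, h3, h4⟩ := leaf_of_even (k := 0) hq hu ha
    exact ⟨Sum.inr (Sum.inl ⟨N, by omega⟩), by simp only [usedInt]; rw [h4]; simp⟩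
  have odd_leaf a u (hu : u < n) (ha : 2 * a + 2 ≤ t) :
      ∃ v, usedInt n t 0 t (t * n) 0 v = 1 + (t * n : ℕ) - n - (a * q + u : ℕ) := by
    obtain ⟨N, h3, h4⟩ := leaf_of_odd (k := 0) hq hu ha
    exact ⟨Sum.inr (Sum.inl ⟨N, by omega⟩), by simp only [usedInt]; rw [h4]⟩
  have even_centre (hz2 : 2 * z ≤ t + 1) :
      ∃ v, usedInt n t 0 t (t * n) 0 v = z - ((t * n : ℕ) + 1) := by
    obtain ⟨b, hb⟩ : ∃ b : ℕ, (b : ℤ) = z - 1 := ⟨(z - 1).toNat, by omega⟩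
    refine ⟨Sum.inl ⟨t - 1 - 2 * b, by omega⟩, ?_⟩
    simp only [usedInt]
    rw [centre_of_even (a := b) (by omega)]
    push_cast
    omega
  by_cases hr : r < n
  · by_cases ha : 2 * a + 1 ≤ t
    · obtain ⟨v, hv⟩ := even_leaf a r hr ha
      exact ⟨v, Or.inr (by omega)⟩
    · by_cases ha' : 2 * a = t ∧ r = 0
      · obtain ⟨b, hb⟩ : ∃ b, a = b + 1 := ⟨a - 1, by omega⟩
        obtain ⟨v, hv⟩ := odd_leaf b (n - 1) (by omega) (by omega)
        have : a * q = b * q + q := by rw [hb]; ring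
        exact ⟨v, Or.inl (by omega)⟩
      · obtain ⟨v, hv⟩ := even_centre (by
          rcases Nat.eq_or_lt_of_le (show t ≤ 2 * a by omega) with h | h
          · have : t * q = 2 * (a * q) := by rw [h]; ring
            omega
          · have := Nat.mul_le_mul_right q h
            rw [mul_assoc, Nat.succ_mul] at this
            omega)
        exact ⟨v, Or.inr hv⟩
  · by_cases ha : 2 * a + 2 ≤ t
    · obtain ⟨v, hv⟩ := odd_leaf a (r - n) (by omega) ha
      exact ⟨v, Or.inl (by omega)⟩
    · obtain ⟨v, hv⟩ := even_centre (by
        have := Nat.mul_le_mul_right q (show t ≤ 2 * a + 1 by omega)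
        rw [add_mul, mul_assoc] at this
        omega)
      exact ⟨v, Or.inr hv⟩

theorem isPacking_even {m n t : ℕ} (hn : 0 < n) (ht : 0 < t) (hm : m = 2 * (t * n) + 2) :
    IsPacking n t (t * n) 0 (fun e => ((centre n t 0 e : ℤ) : ZMod m)) where
  count := rfl
  two_mul_lt := by omega
  two_mul_lt' := by omega
  injective := usedPoint_injective (k := 0) hn (by omega) le_rfl (by omega) (by omega) (by omega)
  centre h := absurd h (lt_irrefl 0)
  add_self_injOn := by
    have : NeZero m := ⟨by omega⟩
    have key (y y' : ZMod m) (hy : y ∈ freePoints n t (t * n) 0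
        (fun e => ((centre n t 0 e : ℤ) : ZMod m)))
        (hy' : y' ∈ freePoints n t (t * n) 0 (fun e => ((centre n t 0 e : ℤ) : ZMod m))) :
        y.valMinAbs - y'.valMinAbs ≠ (t * n : ℕ) + 1 := by
      intro h
      have hz := (ZMod.valMinAbs_mem_Ioc y).2
      have hz' := (ZMod.valMinAbs_mem_Ioc y').1
      obtain ⟨u, hu | hu⟩ := exists_usedInt_eq hn ht (z := y.valMinAbs) (by omega) (by omega)
      · exact hy ⟨u, by rw [usedPoint_eq_cast, hu, ZMod.coe_valMinAbs]⟩
      · refine hy' ⟨u, ?_⟩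
        rw [usedPoint_eq_cast, hu, ← ZMod.coe_valMinAbs y']
        congr 1
        omega
    intro y hy y' hy' h
    have h : y + y = y' + y' := h
    obtain ⟨hz1, hz2⟩ := ZMod.valMinAbs_mem_Ioc y
    obtain ⟨hz3, hz4⟩ := ZMod.valMinAbs_mem_Ioc y'
    have k1 := key y y' hy hy'
    have k2 := key y' y hy' hy
    have h0 : ((2 * (y.valMinAbs - y'.valMinAbs) : ℤ) : ZMod m) = 0 := by
      rw [Int.cast_mul, Int.cast_sub, ZMod.coe_valMinAbs, ZMod.coe_valMinAbs]
      push_cast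
      linear_combination h
    rw [ZMod.intCast_zmod_eq_zero_iff_dvd] at h0
    obtain ⟨j, hj⟩ := h0
    have hmB : (m : ℤ) = 2 * (t * n : ℕ) + 2 := by rw [hm]; push_cast; ring
    have h1 : -2 < j := by
      by_contra hlt
      have : (m : ℤ) * j ≤ m * (-2) := mul_le_mul_of_nonneg_left (by omega) (by omega)
      omega
    have h2 : j < 2 := by
      by_contra hlt
      have : (m : ℤ) * 2 ≤ m * j := mul_le_mul_of_nonneg_left (by omega) (by omega)
      omega
    obtain rfl | rfl | rfl : j = -1 ∨ j = 0 ∨ j = 1 := by omega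
    · omega
    · rw [← ZMod.coe_valMinAbs y, ← ZMod.coe_valMinAbs y', show y.valMinAbs = y'.valMinAbs by omega]
    · omega
  add_self_ne := by
    intro _ _ d hd
    exact absurd hd (Nat.not_lt_zero d)

/-- Sufficiency: the number of columns is `2 + j * n`. -/
theorem exists_existsURD {n h : ℕ} (hn : n + 1 = 2 * h) (hh : 2 ≤ h) (j : ℕ) :
    ∃ s, 1 ≤ s ∧ ExistsURD K₂ (nStar n) ((2 + j * n) * (n + 1)) 1 s := by
  rcases Nat.even_or_odd' j with ⟨t, rfl | rfl⟩
  · rcases Nat.eq_zero_or_pos t with rfl | ht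
    · simpa using existsURD_two_columns (n := n) (by omega)
    · exact (isPacking_even (n := n) (by omega) ht
        (show 2 + 2 * t * n = 2 * (t * n) + 2 by ring)).existsURD_even (by omega) ht (by ring)
  · have hm : 2 + (2 * t + 1) * n = 2 * (t * n + h) + 1 := by
      have : (2 * t + 1) * n = 2 * (t * n) + n := by ring
      omega
    exact (isPacking_odd hn hh hm).existsURD_odd hn hh (by omega) hm

/-! ### Necessity and the number of star factors -/

/-- The number of ordered pairs of adjacent vertices. -/
theorem card_adj_K₂ : Nat.card {p : Fin 2 × Fin 2 // K₂.Adj p.1 p.2} = 2 := by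
  rw [Nat.card_eq_fintype_card, Fintype.card_subtype]
  decide

/-- The number of ordered pairs of adjacent vertices. -/
theorem card_adj_nStar (n : ℕ) :
    Nat.card {p : (Fin 1 ⊕ Fin n) × (Fin 1 ⊕ Fin n) // (nStar n).Adj p.1 p.2} = 2 * n := by
  have e : {p : (Fin 1 ⊕ Fin n) × (Fin 1 ⊕ Fin n) // (nStar n).Adj p.1 p.2} ≃ Fin n ⊕ Fin n :=
    { toFun := fun p => match p with
        | ⟨(Sum.inl _, Sum.inr i), _⟩ => Sum.inl i
        | ⟨(Sum.inr i, Sum.inl _), _⟩ => Sum.inr i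
        | ⟨(Sum.inl _, Sum.inl _), h⟩ => absurd h (by simp)
        | ⟨(Sum.inr _, Sum.inr _), h⟩ => absurd h (by simp)
      invFun := fun i => match i with
        | Sum.inl i => ⟨(Sum.inl 0, Sum.inr i), by simp⟩
        | Sum.inr i => ⟨(Sum.inr i, Sum.inl 0), by simp⟩
      left_inv := by
        rintro ⟨⟨x | x, y | y⟩, h⟩
        · simp at h
        · obtain rfl := Subsingleton.elim x 0
          rfl
        · obtain rfl := Subsingleton.elim y 0
          rfl
        · simp at h
      right_inv := by rintro (i | i) <;> rfl }
  rw [Nat.card_congr e, Nat.card_sum, Nat.card_fin]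
  ring

/-- The number of blocks of a factor is determined by the number of vertices. -/
theorem IsFactor.card_mul_card {v : ℕ} {W : Type} [Finite W] {H : SimpleGraph W}
    {F : Set (SimpleGraph.completeGraph (Fin v)).Subgraph}
    (hF : IsFactor (SimpleGraph.completeGraph (Fin v)) H F) :
    Nat.card F * Nat.card W = v ∧
      Nat.card (Σ B : F, {p : Fin v × Fin v // B.1.Adj p.1 p.2}) =
        Nat.card F * Nat.card {p : W × W // H.Adj p.1 p.2} := by
  have : Fintype F := Fintype.ofFinite F
  have hverts (B : F) : Nat.card B.1.verts = Nat.card W := by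
    obtain ⟨f⟩ := hF.1 B B.2
    exact Nat.card_congr f.toEquiv
  have hadj (B : F) : Nat.card {p : Fin v × Fin v // B.1.Adj p.1 p.2} =
      Nat.card {p : W × W // H.Adj p.1 p.2} := by
    obtain ⟨f⟩ := hF.1 B B.2
    have hf (x y : B.1.verts) : H.Adj (f x) (f y) ↔ B.1.Adj x y := f.map_rel_iff
    refine Nat.card_congr (Equiv.ofBijective
      (fun p => ⟨(f ⟨p.1.1, B.1.edge_vert p.2⟩, f ⟨p.1.2, B.1.edge_vert p.2.symm⟩),
        (hf _ _).2 p.2⟩) ⟨?_, ?_⟩)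
    · rintro ⟨⟨x, y⟩, h⟩ ⟨⟨x', y'⟩, h'⟩ he
      simpa using he
    · rintro ⟨⟨a, b⟩, h⟩
      refine ⟨⟨(f.symm a, f.symm b), (hf _ _).1 (by simpa using h)⟩, by simp⟩
  constructor
  · have e : (Σ B : F, B.1.verts) ≃ Fin v := by
      refine Equiv.ofBijective (fun z => z.2.1) ⟨?_, fun x => ?_⟩
      · rintro ⟨⟨B, hB⟩, x, hx⟩ ⟨⟨B', hB'⟩, x', hx'⟩ h
        obtain rfl : x = x' := h
        obtain rfl : B = B' := (hF.2 x).unique ⟨hB, hx⟩ ⟨hB', hx'⟩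
        rfl
      · obtain ⟨B, ⟨hB, hx⟩, -⟩ := hF.2 x
        exact ⟨⟨⟨B, hB⟩, x, hx⟩, rfl⟩
    have h := Nat.card_congr e
    rw [Nat.card_sigma, Nat.card_fin] at h
    simpa [hverts] using h
  · rw [Nat.card_sigma]
    simp [hadj]

/-- Double counting of vertices and of ordered pairs of vertices. -/
theorem ExistsURD.dvd_and_count {n v s : ℕ} (h : ExistsURD K₂ (nStar n) v 1 s)
    (hs : 1 ≤ s) : n + 1 ∣ v ∧ (v * v) * (n + 1) = v * (2 * (n + 1) + 2 * n * s) := by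
  obtain ⟨P, Q, hD, -, hQQ, hPQ, hP, hQ⟩ := h
  let F : Fin 1 ⊕ Fin s → Set (SimpleGraph.completeGraph (Fin v)).Subgraph := Sum.elim P Q
  have hPP : ∀ i i' : Fin 1, i = i' := fun i i' => Subsingleton.elim i i'
  have hFD σ : F σ ⊆ (⋃ i, P i) ∪ ⋃ j, Q j := by
    rcases σ with i | j
    · exact (Set.subset_iUnion P i).trans Set.subset_union_left
    · exact (Set.subset_iUnion Q j).trans Set.subset_union_right
  have hFdisj σ τ B (hB : B ∈ F σ) (hB' : B ∈ F τ) : σ = τ := by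
    rcases σ with i | j <;> rcases τ with i' | j'
    · rw [hPP i i']
    · exact absurd hB' (Set.disjoint_left.1 (hPQ i j') hB)
    · exact absurd hB (Set.disjoint_left.1 (hPQ i' j) hB')
    · by_contra hne
      exact Set.disjoint_left.1 (hQQ j j' fun h => hne (by rw [h])) hB hB'
  have e : (Σ σ, Σ B : F σ, {p : Fin v × Fin v // B.1.Adj p.1 p.2}) ≃
      {p : Fin v × Fin v // p.1 ≠ p.2} := by
    refine Equiv.ofBijective (fun z => ⟨z.2.2.1, z.2.2.2.ne⟩) ⟨?_, ?_⟩
    · rintro ⟨σ, ⟨B, hB⟩, ⟨p, hp⟩⟩ ⟨σ', ⟨B', hB'⟩, ⟨p', hp'⟩⟩ h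
      obtain rfl : p = p' := congrArg Subtype.val h
      obtain rfl : B = B' := (hD s(p.1, p.2) (by simpa using hp.ne)).unique
        ⟨hFD _ hB, hp⟩ ⟨hFD _ hB', hp'⟩
      obtain rfl := hFdisj _ _ _ hB hB'
      rfl
    · rintro ⟨⟨x, y⟩, hxy⟩
      obtain ⟨B, ⟨hB, hadj⟩, -⟩ := hD s(x, y) (by simpa using hxy)
      obtain ⟨σ, hσ⟩ : ∃ σ, B ∈ F σ := by
        rcases hB with hB | hB
        · obtain ⟨i, hi⟩ := Set.mem_iUnion.1 hB
          exact ⟨Sum.inl i, hi⟩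
        · obtain ⟨j, hj⟩ := Set.mem_iUnion.1 hB
          exact ⟨Sum.inr j, hj⟩
      exact ⟨⟨σ, ⟨B, hσ⟩, ⟨(x, y), hadj⟩⟩, rfl⟩
  have hcard := Nat.card_congr e
  have hoff : Nat.card {p : Fin v × Fin v // p.1 ≠ p.2} + v = v * v := by
    have h1 : Nat.card {p : Fin v × Fin v // p.1 = p.2} = v := by
      rw [Nat.card_congr (β := Fin v)
        { toFun := fun p => p.1.1
          invFun := fun x => ⟨(x, x), rfl⟩
          left_inv := by rintro ⟨⟨x, y⟩, h⟩; simp only at h; subst h; rfl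
          right_inv := fun x => rfl }, Nat.card_fin]
    have h2 := Nat.card_congr (Equiv.sumCompl fun p : Fin v × Fin v => p.1 = p.2)
    rw [Nat.card_sum, h1, Nat.card_prod, Nat.card_fin] at h2
    rw [← h2, add_comm]
  obtain ⟨hP1, hP2⟩ := (hP 0).card_mul_card
  rw [card_adj_K₂] at hP2
  rw [Nat.card_fin] at hP1
  have hQ1 j : Nat.card (Q j) * (n + 1) = v := by
    have := (hQ j).card_mul_card.1
    rwa [Nat.card_sum, Nat.card_fin, Nat.card_fin, add_comm 1 n] at this
  have hQ2 j := (hQ j).card_mul_card.2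
  simp only [card_adj_nStar] at hQ2
  rw [Nat.card_sigma, Fintype.sum_sum_type] at hcard
  simp only [F, Sum.elim_inl, Sum.elim_inr, Finset.univ_unique, Finset.sum_singleton,
    Fin.default_eq_zero] at hcard
  rw [hP2] at hcard
  simp only [hQ2] at hcard
  refine ⟨⟨_, (hQ1 ⟨0, hs⟩).symm.trans (mul_comm _ _)⟩, ?_⟩
  have hsum : (∑ j, Nat.card (Q j) * (2 * n)) * (n + 1) = s * (v * (2 * n)) := by
    rw [Finset.sum_mul]
    simp only [mul_right_comm _ (2 * n), hQ1]
    simp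
  rw [← hoff, ← hcard, hP1, add_mul, add_mul, hsum]
  ring

/-- The number of star factors. -/
theorem ExistsURD.count {n v s : ℕ} (hv : 0 < v)
    (h : ExistsURD K₂ (nStar n) v 1 s) (hs : 1 ≤ s) :
    n + 1 ∣ v ∧ v * (n + 1) = 2 * (n + 1) + 2 * n * s := by
  obtain ⟨h1, h2⟩ := h.dvd_and_count hs
  exact ⟨h1, Nat.eq_of_mul_eq_mul_left hv (by rw [← h2, mul_assoc])⟩

end StarURD

theorem mainTheorem1 (n v : ℕ) (hn : 1 < n) (hodd : Odd n) (hv : 0 < v) :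
    ((∃ s : ℕ, 1 ≤ s ∧ StarURD.ExistsURD StarURD.K₂ (StarURD.nStar n) v 1 s) ↔
      v ≡ 2 * (n + 1) [MOD n * (n + 1)]) ∧
    (∀ s : ℕ, 1 ≤ s → StarURD.ExistsURD StarURD.K₂ (StarURD.nStar n) v 1 s →
      (s : ℚ) = ((v : ℚ) - 2) * ((n : ℚ) + 1) / (2 * (n : ℚ))) := by
  refine ⟨⟨?_, fun h => ?_⟩, fun s hs h => ?_⟩
  · rintro ⟨s, hs, h⟩
    obtain ⟨h1, h2⟩ := h.count hv hs
    have hcop : Nat.Coprime n (n + 1) := by simp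
    rw [← Nat.modEq_and_modEq_iff_modEq_mul hcop]
    constructor
    · -- modulo `n`, the count `v (n + 1) = 2 (n + 1) + 2 n s` says `v ≡ 2`
      have h3 : v * (n + 1) ≡ 2 * (n + 1) [MOD n] := by
        rw [h2, mul_comm 2 n, mul_assoc]
        exact Nat.ModEq.trans (Nat.ModEq.add_left _ (Nat.modEq_zero_iff_dvd.2 ⟨2 * s, rfl⟩)) rfl
      have h4 : v * (n + 1) ≡ v [MOD n] := by
        simp [Nat.ModEq, mul_add]
      exact h4.symm.trans h3
    · exact (Nat.modEq_zero_iff_dvd.2 h1).trans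
        (Nat.modEq_zero_iff_dvd.2 (Dvd.intro_left _ rfl)).symm
  · obtain ⟨h', hh⟩ := hodd
    have hlt : 2 * (n + 1) < n * (n + 1) := by
      apply Nat.mul_lt_mul_of_pos_right <;> omega
    have hle : 2 * (n + 1) ≤ v := by
      rw [← Nat.mod_eq_of_lt hlt, ← show v % _ = _ from h]
      exact Nat.mod_le _ _
    obtain ⟨j, hj⟩ := (Nat.modEq_iff_dvd' hle).1 h.symm
    have hvj : v = (2 + j * n) * (n + 1) := by
      have : (2 + j * n) * (n + 1) = 2 * (n + 1) + n * (n + 1) * j := by ring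
      omega
    rw [hvj]
    exact StarURD.exists_existsURD (h := h' + 1) (by omega) (by omega) j
  · obtain ⟨-, h2⟩ := h.count hv hs
    have h3 : (v : ℚ) * (n + 1) = 2 * (n + 1) + 2 * n * s := by exact_mod_cast h2
    have hn0 : (n : ℚ) ≠ 0 := by positivity
    field_simp
    linear_combination -h3
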